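/- **Theorem 1 (asymptotic optimality of the DGF policy).** Let $2\le M$, $1\le K\le M$. A single target lies in one of $M$ cells, in cell $m$ with prior probability $\pi_m$, where $0<\pi_m<1$ and $\sum_m\pi_m=1$. At each time $n=1,2,\dots$ a decision maker selects $K$ different cells and observes $y_k(n)$ for each selected cell $k$. All observations are independent; when the target is in cell $m$ (hypothesis $H_m$, with probability $\mathbf P_m$ and expectation $\mathbf E_m$), those of cell $m$ have distribution $g$ and those of every other cell have distribution $f$. Here $f\ne g$ are probability distributions whose Kullback–Leibler divergences $D(g\|f)$ and $D(f\|g)$ are both finite. A strategy $\Gamma=(\tau,\delta,\phi)$ consists of a selection rule $\phi$, under which the cells selected at time $n$ are a (deterministic or randomized) function of all selections and observations before time $n$, a stopping time $\tau$, and a declared cell $\delta$, the last two determined by the selections and observations made up to the time of stopping. For a sampling cost $c>0$ its Bayes risk is $$R(\Gamma)=\sum_{m=1}^M\pi_m\bigl(\mathbf P_m(\delta\ne m)+c\,\mathbf E_m(\tau)\bigr).$$ Let $S_k(n)$ be the sum of the log-likelihood ratios $\log\frac{g(y_k(t))}{f(y_k(t))}$ over the times $t\le n$ at which cell $k$ was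 observed, and let $m^{(i)}(n)$ be the cell with the $i$-th highest sum $S_k(n)$, where ties are broken by an arbitrary fixed (measurable) rule based on the past selections and observations. The DGF policy selects, on the basis of the sums observed so far, the cells $m^{(1)}(n),\dots,m^{(K)}(n)$ if $D(g\|f)\ge D(f\|g)/(M-1)$ or $K=M$, and the cells $m^{(2)}(n),\dots,m^{(K+1)}(n)$ otherwise. It stops at $\tau=\inf\{n: S_{m^{(1)}(n)}(n)-S_{m^{(2)}(n)}(n)\ge-\log c\}$ and declares $\delta=m^{(1)}(\tau)$. Let $$I^*(M,K)=\begin{cases}D(g\|f)+D(f\|g), & K=M,\\[2pt] \max\Bigl[\dfrac{K\,D(f\|g)}{M-1},\; D(g\|f)+\dfrac{(K-1)D(f\|g)}{M-1}\Bigr], & K<M.\end{cases}$$ Then the Bayes risk $R^*$ of the DGF policy satisfies $$R^*\;\sim\;\frac{-c\log c}{I^*(M,K)}\;\sim\;\inf_\Gamma R(\Gamma)\qquad\text{as } c\to0^+,$$ where $u\sim v$ means $u/v\to1$ and the infimum is over all strategies $\Gamma$. -/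

import Mathlib

open MeasureTheory InformationTheory
open scoped ENNReal Topology

noncomputable section

namespace AnomalyDetection

variable {𝓨 : Type*} [MeasurableSpace 𝓨]

/-- A selection of `K` different cells out of `M`, listed as a vector. -/
abbrev Selection (M K : ℕ) : Type := {a : Fin K → Fin M // Function.Injective a}

/-- The data gathered in one time step: the cells selected, and the vector of the observations
made in them. -/
abbrev Record (𝓨 : Type*) (M K : ℕ) : Type _ := Selection M K × (Fin K → 𝓨)

/-- All selections and observations of the first `n` time steps. Entry `t : Fin n` belongs to
time `t + 1`. -/
abbrev History (𝓨 : Type*) (M K n : ℕ) : Type _ := Fin n → Record 𝓨 M K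

/-- An admissible (possibly randomized) strategy: selection rule, stopping rule and decision rule.
The selection at time `n + 1` is a function of the history of the first `n` steps and of a fresh
uniform random number, so that given the history it has an arbitrary probability mass function on
the selections (deterministic rules ignore the random number). The strategy stops at the first `n`
for which the history up to time `n` lies in `stopSet n`, and then declares the cell given by
`decide n`. -/
structure Strategy (𝓨 : Type*) [MeasurableSpace 𝓨] (M K : ℕ) where
  select : ∀ n, History 𝓨 M K n × unitInterval → Selection M K
  measurable_select : ∀ n, Measurable (select n)
  stopSet : ∀ n, Set (History 𝓨 M K n)
  measurableSet_stopSet : ∀ n, MeasurableSet (stopSet n)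
  decide : ∀ n, History 𝓨 M K n → Fin M
  measurable_decide : ∀ n, Measurable (decide n)

/-- The sample space: the random numbers available to the selection rule, and the table of the
observations `y_k(n)` of all cells at all times, of which a strategy sees only the entries that it
selects. The entries with index `n` belong to time `n + 1`. -/
abbrev SampleSpace (𝓨 : Type*) (M : ℕ) : Type _ := (ℕ → unitInterval) × (ℕ → Fin M → 𝓨)

/-- The probability measure when the target is in cell `m`: everything is independent, the
observations of cell `m` have law `g`, those of all other cells have law `f`. -/
def law (f g : Measure 𝓨) {M : ℕ} (m : Fin M) : Measure (SampleSpace 𝓨 M) :=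
  (Measure.infinitePi fun _ : ℕ => (volume : Measure unitInterval)).prod
    (Measure.infinitePi fun _ : ℕ => Measure.pi fun k : Fin M => if k = m then g else f)

namespace Strategy

variable {M K : ℕ}

/-- The history of the first `n` time steps produced by a strategy (disregarding its stopping
rule). -/
def history (Γ : Strategy 𝓨 M K) (ω : SampleSpace 𝓨 M) : ∀ n, History 𝓨 M K n
  | 0 => Fin.elim0
  | n + 1 =>
    let a := Γ.select n (history Γ ω n, ω.1 n)
    Fin.snoc (α := fun _ => Record 𝓨 M K) (history Γ ω n) (a, fun i => ω.2 n (a.1 i))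

/-- The stopping time `τ`, with the value `∞` if the strategy never stops. -/
def stopTime (Γ : Strategy 𝓨 M K) (ω : SampleSpace 𝓨 M) : ℕ∞ :=
  ⨅ (n : ℕ) (_ : Γ.history ω n ∈ Γ.stopSet n), (n : ℕ∞)

/-- The event that the strategy stops and declares cell `m`. -/
def declares (Γ : Strategy 𝓨 M K) (m : Fin M) : Set (SampleSpace 𝓨 M) :=
  {ω | ∃ n : ℕ, Γ.stopTime ω = n ∧ Γ.decide n (Γ.history ω n) = m}

/-- The probability `α_m` of not declaring `m` when the target is in cell `m`. -/
def errorProb (f g : Measure 𝓨) (Γ : Strategy 𝓨 M K) (m : Fin M) : ℝ≥0∞ :=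
  law f g m (Γ.declares m)ᶜ

/-- The expected detection time when the target is in cell `m`. -/
def expectedTime (f g : Measure 𝓨) (Γ : Strategy 𝓨 M K) (m : Fin M) : ℝ≥0∞ :=
  ∫⁻ ω, (Γ.stopTime ω : ℝ≥0∞) ∂(law f g m)

/-- The Bayes risk `∑ π_m (α_m + c E_m τ)`. -/
def bayesRisk (f g : Measure 𝓨) (prior : Fin M → ℝ) (c : ℝ) (Γ : Strategy 𝓨 M K) : ℝ≥0∞ :=
  ∑ m, ENNReal.ofReal (prior m) *
    (Γ.errorProb f g m + ENNReal.ofReal c * Γ.expectedTime f g m)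

end Strategy

/-- The Kullback-Leibler divergence `D(p‖q)` as a real number. -/
def kl (p q : Measure 𝓨) : ℝ := (klDiv p q).toReal

/-- The rate function `I*(M, K)`. -/
def rate (f g : Measure 𝓨) (M K : ℕ) : ℝ :=
  if K = M then kl g f + kl f g
  else max ((K : ℝ) * kl f g / ((M : ℝ) - 1)) (kl g f + ((K : ℝ) - 1) * kl f g / ((M : ℝ) - 1))

/-- The observed sum of log-likelihood ratios `log (dg/df)` of cell `k`. -/
def sumLLR (f g : Measure 𝓨) {M K n : ℕ} (h : History 𝓨 M K n) (k : Fin M) : ℝ :=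
  ∑ t : Fin n, ∑ i : Fin K, if (h t).1.1 i = k then llr g f ((h t).2 i) else 0

lemma measurable_sumLLR (f g : Measure 𝓨) {M K n : ℕ} (k : Fin M) :
    Measurable fun h : History 𝓨 M K n => sumLLR f g h k := by
  unfold sumLLR
  refine Finset.measurable_sum _ fun t _ => Finset.measurable_sum _ fun i _ => ?_
  refine Measurable.ite ?_ ((measurable_llr g f).comp (by fun_prop)) measurable_const
  have hm : Measurable fun h : History 𝓨 M K n => (h t).1.1 i :=
    (measurable_pi_apply i).comp
      (measurable_subtype_coe.comp (measurable_fst.comp (measurable_pi_apply t)))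
  exact hm (measurableSet_singleton k)

/-- A ranking of the cells by their observed sums of log-likelihood ratios, highest first: `cell n h i`
is the cell `m^{(i+1)}(n)` with the `(i+1)`-th highest sum given the history `h` of the first
`n` steps. Cells with equal sums are ordered in an arbitrary (measurable) way. -/
structure Ranking (f g : Measure 𝓨) (M K : ℕ) where
  cell : ∀ n, History 𝓨 M K n → Fin M → Fin M
  injective : ∀ n h, Function.Injective (cell n h)
  antitone : ∀ n h, Antitone fun i => sumLLR f g h (cell n h i)
  measurable : ∀ n, Measurable (cell n)

/-- Rankings exist: break ties by the index of the cell. -/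
instance (f g : Measure 𝓨) (M K : ℕ) : Inhabited (Ranking f g M K) where
  default :=
    { cell := fun _ h => Tuple.sort fun k => -sumLLR f g h k
      injective := fun _ _ => Equiv.injective _
      antitone := fun _ h i j hij =>
        neg_le_neg_iff.1 (Tuple.monotone_sort (fun k => -sumLLR f g h k) hij)
      measurable := fun n => by
        refine measurable_pi_iff.2 fun i => measurable_to_countable' fun k => ?_
        have hs : ∀ σ : Equiv.Perm (Fin M), MeasurableSet
            {h : History 𝓨 M K n | σ = Tuple.sort fun k => -sumLLR f g h k} := by
          intro σ
          simp only [Tuple.eq_sort_iff, Monotone, Function.comp, neg_le_neg_iff, neg_inj,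
            Set.ofPred_and, Set.ofPred_forall]
          refine MeasurableSet.inter ?_ ?_
          · exact .iInter fun i => .iInter fun j => .iInter fun _ =>
              measurableSet_le (measurable_sumLLR f g _) (measurable_sumLLR f g _)
          · exact .iInter fun i => .iInter fun j => .iInter fun _ =>
              measurableSet_setOfPred.2 ((measurableSet_setOfPred.1 (measurableSet_eq_fun
                (measurable_sumLLR f g _) (measurable_sumLLR f g _))).imp measurable_const)
        have he : (fun h : History 𝓨 M K n => (Tuple.sort fun k => -sumLLR f g h k) i) ⁻¹' {k} =
            ⋃ σ : Equiv.Perm (Fin M), ⋃ _ : σ i = k,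
              {h : History 𝓨 M K n | σ = Tuple.sort fun k => -sumLLR f g h k} := by
          ext h
          simp
        rw [he]
        exact .iUnion fun σ => .iUnion fun _ => hs σ }

lemma measurable_sumLLR_cell {f g : Measure 𝓨} {M K : ℕ} (r : Ranking f g M K) (n : ℕ)
    (i : Fin M) : Measurable fun h : History 𝓨 M K n => sumLLR f g h (r.cell n h i) := by
  have he : (fun h : History 𝓨 M K n => sumLLR f g h (r.cell n h i)) =
      fun h => ∑ k, if r.cell n h i = k then sumLLR f g h k else 0 := by
    ext h
    simp
  rw [he]
  refine Finset.measurable_sum _ fun k _ => ?_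
  exact Measurable.ite (((measurable_pi_apply i).comp (r.measurable n)) (measurableSet_singleton k))
    (measurable_sumLLR f g k) measurable_const

/-- The position in the ranking of the `i`-th cell that the DGF policy selects: the positions
`1, …, K`, or, if `K < M` and `D(g‖f) < D(f‖g)/(M-1)`, the positions `2, …, K+1`
(counted from `0` here). -/
def dgfPosition (f g : Measure 𝓨) {M K : ℕ} (hKM : K ≤ M) (i : Fin K) : Fin M :=
  open Classical in
  if h : kl g f < kl f g / ((M : ℝ) - 1) ∧ K < M then ⟨i + 1, by have := i.2; omega⟩
  else ⟨i, by omega⟩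

lemma dgfPosition_injective (f g : Measure 𝓨) {M K : ℕ} (hKM : K ≤ M) :
    Function.Injective (dgfPosition f g hKM) := by
  intro i j hij
  unfold dgfPosition at hij
  split_ifs at hij <;> simpa [Fin.ext_iff] using hij

/-- The DGF policy with sampling cost `c`: it probes the cells at the above positions of the
ranking, stops as soon as the difference between the highest and the second highest sum is at
least `-log c`, and declares the cell with the highest sum. -/
def dgf {f g : Measure 𝓨} {M K : ℕ} (hM : 2 ≤ M) (hKM : K ≤ M) (r : Ranking f g M K) (c : ℝ) :
    Strategy 𝓨 M K where
  select n x := ⟨fun i => r.cell n x.1 (dgfPosition f g hKM i),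
    (r.injective n x.1).comp (dgfPosition_injective f g hKM)⟩
  measurable_select n := Measurable.subtype_mk <| measurable_pi_iff.2 fun i =>
    (measurable_pi_iff.1 (r.measurable n) _).comp measurable_fst
  stopSet n := {h | -Real.log c ≤
    sumLLR f g h (r.cell n h ⟨0, by omega⟩) - sumLLR f g h (r.cell n h ⟨1, by omega⟩)}
  measurableSet_stopSet n := by
    have h0 := measurable_sumLLR_cell r n ⟨0, by omega⟩
    have h1 := measurable_sumLLR_cell r n ⟨1, by omega⟩
    exact measurableSet_le measurable_const (h0.sub h1)
  decide n h := r.cell n h ⟨0, by omega⟩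
  measurable_decide n := measurable_pi_iff.1 (r.measurable n) _

/-- `u ∼ v` as `c → 0` through positive values: the ratio `u / v` tends to `1`. -/
def AsympEq (u v : ℝ → ℝ≥0∞) : Prop :=
  Filter.Tendsto (fun c => u c / v c) (𝓝[>] (0 : ℝ)) (𝓝 1)

end AnomalyDetection

end

/-! The asymptotics of the Bayes risk follow from a lower bound for every strategy and an upper
bound for the DGF policy. Write `L = -log c`, let `S k` be the observed sums of log-likelihood
ratios, and let `m` be the target. Only the finiteness of the two divergences is available, so no second
moments are used anywhere.

*Compensators.* Whatever the strategy, `S k` is close to `drift f g m k` times the number of probes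
of cell `k`, uniformly over time and over the strategies
(`exists_forall_measure_sumLLR_sub_le`). This maximal weak law needs first moments only: the
log-likelihood ratio is split into a bounded part, which obeys Hoeffding's bound, and a part that
is small in `L¹`.

*Lower bound.* The likelihood ratio of the observed history is `exp (S m - S j)`
(`lintegral_history_change`). A strategy whose risk is at most of order `c * L` has error
probabilities of that order, so by the change of measure all the differences `S m - S j` are at
least about `L` when it stops and declares `m`. The smallest difference is at most their average,
whose compensator grows by at most `rate f g M K` per step, as only `K` cells are probed
(`exists_margin_le_rate_mul`). Hence stopping before about `L / rate f g M K` is unlikely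
(`eventually_le_expectedTime`).

*Upper bound.* The potential `∑ A, exp (∑ k ∈ A, (S k - S m) / M)`, over the nonempty sets `A` of
null cells, decays geometrically under the DGF policy (`exists_lintegral_potential_le`): no term
increases in expectation, a term shrinks by a fixed factor when the target or a cell of `A` is
probed, and every term is dominated by such a term (`exists_dominating_nullSet`). Hence the target
leads for good from some time on, with geometric tails. While it leads, the policy keeps the numbers
of probes of the null cells balanced (`kl_mul_probes_sub_le`), because it probes those with the
highest sums; so by the weak law all the differences `S m - S k` grow at the rate `rate f g M K`
(`rate_mul_sub_le_margin`). The policy therefore stops by about `L / rate f g M K` with high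
probability, and the geometric tail controls the remainder of the expectation
(`exists_tsum_measure_notMem_stopSet_le`). Its error probability is at most `M * c` by the change
of measure (`errorProb_dgf_le`), which is negligible. -/

noncomputable section

namespace AnomalyDetection

/-! ### One time step of a strategy -/

section Resampling

/-- Replacing coordinate `n` of an infinite product by an independent copy preserves the law. -/
lemma infinitePi_map_update {A : Type*} [MeasurableSpace A] (P : ℕ → Measure A)
    [∀ i, IsProbabilityMeasure (P i)] (n : ℕ) :
    ((Measure.infinitePi P).prod (P n)).map (fun p => Function.update p.1 n p.2)
      = Measure.infinitePi P := by
  have hmeas : Measurable fun p : (ℕ → A) × A => Function.update p.1 n p.2 := by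
    refine measurable_pi_iff.2 fun i => ?_
    by_cases hi : i = n
    · subst hi; simpa using measurable_snd
    · simp only [Function.update_of_ne hi]; fun_prop
  refine Measure.eq_infinitePi P fun s t ht => ?_
  rw [Measure.map_apply hmeas (MeasurableSet.pi s.countable_toSet fun i _ => ht i)]
  have hpre : (fun p : (ℕ → A) × A => Function.update p.1 n p.2) ⁻¹' Set.pi s t
      = Set.pi (s.erase n : Finset ℕ) t ×ˢ (if n ∈ s then t n else Set.univ) := by
    ext ⟨x, a⟩
    simp only [Set.mem_preimage, Set.mem_pi, Set.mem_prod, Finset.mem_coe, Finset.mem_erase]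
    constructor
    · intro h
      refine ⟨fun i hi => by simpa [hi.1] using h i hi.2, ?_⟩
      split_ifs with hn
      · simpa using h n hn
      · trivial
    · rintro ⟨h1, h2⟩ i hi
      by_cases hin : i = n
      · subst hin; simpa [hi] using h2
      · simpa [hin] using h1 i ⟨hin, hi⟩
  rw [hpre, Measure.prod_prod, Measure.infinitePi_pi P fun i _ => ht i]
  split_ifs with hn
  · rw [Finset.prod_erase_mul _ _ hn]
  · simp [Finset.erase_eq_of_notMem hn]

lemma lintegral_infinitePi_update {A : Type*} [MeasurableSpace A] (P : ℕ → Measure A)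
    [∀ i, IsProbabilityMeasure (P i)] (n : ℕ) {F : (ℕ → A) → ℝ≥0∞} (hF : Measurable F) :
    ∫⁻ x, F x ∂Measure.infinitePi P
      = ∫⁻ x, ∫⁻ a, F (Function.update x n a) ∂P n ∂Measure.infinitePi P := by
  have hmeas : Measurable fun p : (ℕ → A) × A => Function.update p.1 n p.2 := by
    refine measurable_pi_iff.2 fun i => ?_
    by_cases hi : i = n
    · subst hi; simpa using measurable_snd
    · simp only [Function.update_of_ne hi]; fun_prop
  conv_lhs => rw [← infinitePi_map_update P n]
  rw [lintegral_map hF hmeas]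
  exact lintegral_prod _ (hF.comp hmeas).aemeasurable

/-- The integral of a product of functions of distinct coordinates factorizes. -/
lemma lintegral_pi_prod {ι A : Type*} [Fintype ι] [MeasurableSpace A] (μ : ι → Measure A)
    [∀ i, IsProbabilityMeasure (μ i)] {F : ι → A → ℝ≥0∞} (hF : ∀ i, Measurable (F i)) :
    ∫⁻ x, ∏ i, F i (x i) ∂Measure.pi μ = ∏ i, ∫⁻ y, F i y ∂μ i := by
  have hind := ProbabilityTheory.iIndepFun_pi (μ := μ) fun i => (hF i).aemeasurable
  have h := ProbabilityTheory.lintegral_prod_eq_prod_lintegral_of_indepFun Finset.univ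
    (fun i (x : ι → A) => F i (x i)) hind fun i => (hF i).comp (measurable_pi_apply i)
  rw [h]
  refine Finset.prod_congr rfl fun i _ => ?_
  exact (measurePreserving_eval μ i).lintegral_comp (hF i)

end Resampling

section ObservedSum

variable {𝓨 : Type*} {M K : ℕ}

/-- The sum of `φ` over the observations made in cell `k`. With `φ = log (dg/df)` it is
`sumLLR`, with `φ = 1` the number of times that cell `k` has been selected. -/
def observedSum (φ : 𝓨 → ℝ) {n : ℕ} (h : History 𝓨 M K n) (k : Fin M) : ℝ :=
  ∑ t : Fin n, ∑ i : Fin K, if (h t).1.1 i = k then φ ((h t).2 i) else 0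

lemma observedSum_zero (φ : 𝓨 → ℝ) (h : History 𝓨 M K 0) (k : Fin M) :
    observedSum φ h k = 0 := by simp [observedSum]

lemma observedSum_snoc (φ : 𝓨 → ℝ) {n : ℕ} (h : History 𝓨 M K n) (x : Record 𝓨 M K) (k : Fin M) :
    observedSum φ (Fin.snoc (α := fun _ => Record 𝓨 M K) h x : History 𝓨 M K (n + 1)) k
      = observedSum φ h k + ∑ i, if x.1.1 i = k then φ (x.2 i) else 0 := by
  simp [observedSum, Fin.sum_univ_castSucc]

lemma observedSum_add (φ ψ : 𝓨 → ℝ) {n : ℕ} (h : History 𝓨 M K n) (k : Fin M) :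
    observedSum (fun y => φ y + ψ y) h k = observedSum φ h k + observedSum ψ h k := by
  simp only [observedSum, ← Finset.sum_add_distrib]
  refine Finset.sum_congr rfl fun t _ => Finset.sum_congr rfl fun i _ => ?_
  split_ifs <;> simp

lemma observedSum_const_mul (c : ℝ) (φ : 𝓨 → ℝ) {n : ℕ} (h : History 𝓨 M K n) (k : Fin M) :
    observedSum (fun y => c * φ y) h k = c * observedSum φ h k := by
  simp only [observedSum, Finset.mul_sum, mul_ite, mul_zero]

lemma sum_mul_observedSum_snoc (φ : 𝓨 → ℝ) (w : Fin M → ℝ) {n : ℕ} (h : History 𝓨 M K n)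
    (x : Record 𝓨 M K) :
    ∑ k, w k * observedSum φ (Fin.snoc (α := fun _ => Record 𝓨 M K) h x : History 𝓨 M K (n + 1)) k
      = ∑ k, w k * observedSum φ h k + ∑ i, w (x.1.1 i) * φ (x.2 i) := by
  simp only [observedSum_snoc, mul_add, Finset.sum_add_distrib, Finset.mul_sum]
  congr 1
  rw [Finset.sum_comm]
  simp

end ObservedSum

section History

variable {𝓨 : Type*} [MeasurableSpace 𝓨] {M K : ℕ}

/-- The law of an observation of cell `k` when the target is in cell `m`. -/
def cellLaw (f g : Measure 𝓨) {M : ℕ} (m k : Fin M) : Measure 𝓨 := if k = m then g else f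

/-- The law of the vector of observations made in the cells `a` when the target is in cell `m`. -/
def obsLaw (f g : Measure 𝓨) {M K : ℕ} (m : Fin M) (a : Selection M K) : Measure (Fin K → 𝓨) :=
  Measure.pi fun i => cellLaw f g m (a.1 i)

instance (f g : Measure 𝓨) [IsProbabilityMeasure f] [IsProbabilityMeasure g] (m k : Fin M) :
    IsProbabilityMeasure (cellLaw f g m k) := by
  unfold cellLaw; split_ifs <;> infer_instance

instance (f g : Measure 𝓨) [IsProbabilityMeasure f] [IsProbabilityMeasure g] (m : Fin M)
    (a : Selection M K) : IsProbabilityMeasure (obsLaw f g m a) := by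
  unfold obsLaw; infer_instance

instance (f g : Measure 𝓨) [IsProbabilityMeasure f] [IsProbabilityMeasure g] (m k : Fin M) :
    IsProbabilityMeasure (if k = m then g else f) := by
  split_ifs <;> infer_instance

instance (f g : Measure 𝓨) [IsProbabilityMeasure f] [IsProbabilityMeasure g] (m : Fin M) :
    IsProbabilityMeasure (law f g m) := by
  unfold law; infer_instance

lemma pi_map_selection (f g : Measure 𝓨) [IsProbabilityMeasure f] [IsProbabilityMeasure g]
    (m : Fin M) (a : Selection M K) :
    (Measure.pi fun k : Fin M => if k = m then g else f).map (fun y i => y (a.1 i))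
      = obsLaw f g m a := by
  have h := Measure.map_infinitePi_infinitePi_of_inj
    (P := fun k : Fin M => if k = m then g else f) a.2
  rw [Measure.infinitePi_eq_pi, Measure.infinitePi_eq_pi] at h
  exact h

lemma lintegral_obsLaw (f g : Measure 𝓨) [IsProbabilityMeasure f] [IsProbabilityMeasure g]
    (m : Fin M) (a : Selection M K) {F : (Fin K → 𝓨) → ℝ≥0∞} (hF : Measurable F) :
    ∫⁻ z, F z ∂obsLaw f g m a
      = ∫⁻ y, F (fun i => y (a.1 i)) ∂Measure.pi fun k : Fin M => if k = m then g else f := by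
  rw [← pi_map_selection, lintegral_map hF]
  exact measurable_pi_iff.2 fun i => measurable_pi_apply _

lemma measurable_snoc (n : ℕ) :
    Measurable fun p : History 𝓨 M K n × Record 𝓨 M K =>
      (Fin.snoc (α := fun _ => Record 𝓨 M K) p.1 p.2 : History 𝓨 M K (n + 1)) := by
  refine measurable_pi_iff.2 fun i => ?_
  induction i using Fin.lastCases with
  | last => simpa using measurable_snd
  | cast i => simpa [Function.comp_def] using ((measurable_pi_apply i).comp measurable_fst :
      Measurable fun p : History 𝓨 M K n × Record 𝓨 M K => p.1 i)

/-- Reading off the observations of the selected cells is jointly measurable, because there are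
only finitely many selections. -/
lemma measurable_observe :
    Measurable fun p : Selection M K × (Fin M → 𝓨) => fun i => p.2 (p.1.1 i) := by
  refine measurable_from_prod_countable_right fun a => ?_
  exact measurable_pi_iff.2 fun i => measurable_pi_apply (a.1 i)

namespace Strategy

variable (Γ : Strategy 𝓨 M K)

lemma history_succ (ω : SampleSpace 𝓨 M) (n : ℕ) :
    Γ.history ω (n + 1) = Fin.snoc (α := fun _ => Record 𝓨 M K) (Γ.history ω n)
      (Γ.select n (Γ.history ω n, ω.1 n),
        fun i => ω.2 n ((Γ.select n (Γ.history ω n, ω.1 n)).1 i)) := rfl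

lemma measurable_history (n : ℕ) : Measurable fun ω => Γ.history ω n := by
  induction n with
  | zero => exact measurable_const
  | succ n ih =>
    have hsel : Measurable fun ω => Γ.select n (Γ.history ω n, ω.1 n) :=
      (Γ.measurable_select n).comp (ih.prodMk (by fun_prop))
    exact (measurable_snoc n).comp (ih.prodMk (hsel.prodMk
      (measurable_observe.comp (hsel.prodMk (by fun_prop : Measurable fun ω : SampleSpace 𝓨 M =>
        ω.2 n)))))

lemma history_congr {ω ω' : SampleSpace 𝓨 M} {n : ℕ}
    (h : ∀ t < n, ω.1 t = ω'.1 t ∧ ω.2 t = ω'.2 t) : Γ.history ω n = Γ.history ω' n := by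
  induction n with
  | zero => rfl
  | succ n ih =>
    rw [history_succ, history_succ, ih fun t ht => h t (by omega), (h n (by omega)).1,
      (h n (by omega)).2]

lemma history_update (ω : SampleSpace 𝓨 M) (n : ℕ) (u : unitInterval) (y : Fin M → 𝓨) :
    Γ.history (Function.update ω.1 n u, Function.update ω.2 n y) n = Γ.history ω n :=
  Γ.history_congr fun t ht => by simp [ht.ne]

lemma history_apply_castLE (ω : SampleSpace 𝓨 M) {t n : ℕ} (h : t ≤ n) (i : Fin t) :
    Γ.history ω n (Fin.castLE h i) = Γ.history ω t i := by
  induction n, h using Nat.le_induction with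
  | base => rfl
  | succ n hn ih =>
    rw [← ih, history_succ]
    exact Fin.snoc_castSucc (α := fun _ => Record 𝓨 M K) _ _ (Fin.castLE hn i)

lemma measurable_lintegral_step (f g : Measure 𝓨) [IsProbabilityMeasure f]
    [IsProbabilityMeasure g] (m : Fin M) (n : ℕ) {F : History 𝓨 M K (n + 1) → ℝ≥0∞}
    (hF : Measurable F) :
    Measurable fun h : History 𝓨 M K n => ∫⁻ u : unitInterval, ∫⁻ z,
      F (Fin.snoc (α := fun _ => Record 𝓨 M K) h (Γ.select n (h, u), z))
        ∂obsLaw f g m (Γ.select n (h, u)) := by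
  have hFz : ∀ (h : History 𝓨 M K n) (a : Selection M K), Measurable fun z : Fin K → 𝓨 =>
      F (Fin.snoc (α := fun _ => Record 𝓨 M K) h (a, z)) := fun h a =>
    hF.comp ((measurable_snoc n).comp
      (measurable_const.prodMk (measurable_const.prodMk measurable_id)))
  simp only [lintegral_obsLaw f g m _ (hFz _ _)]
  have hsel := Γ.measurable_select n
  have hJ : Measurable fun p : (History 𝓨 M K n × unitInterval) × (Fin M → 𝓨) =>
      F (Fin.snoc (α := fun _ => Record 𝓨 M K) p.1.1
        (Γ.select n (p.1.1, p.1.2), fun i => p.2 ((Γ.select n (p.1.1, p.1.2)).1 i))) :=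
    hF.comp ((measurable_snoc n).comp ((measurable_fst.comp measurable_fst).prodMk
      ((hsel.comp measurable_fst).prodMk
        (measurable_observe.comp ((hsel.comp measurable_fst).prodMk measurable_snd)))))
  exact (Measurable.lintegral_prod_right' hJ).lintegral_prod_right'

/-- The one-step formula: given the history of the first `n` steps, the selection is drawn by
means of a uniform random number, and the observations of the selected cells are independent of
the past, with the law that belongs to their cells. -/
lemma lintegral_history_succ (f g : Measure 𝓨) [IsProbabilityMeasure f] [IsProbabilityMeasure g]
    (m : Fin M) (n : ℕ) {F : History 𝓨 M K (n + 1) → ℝ≥0∞} (hF : Measurable F) :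
    ∫⁻ ω, F (Γ.history ω (n + 1)) ∂law f g m
      = ∫⁻ ω, ∫⁻ u : unitInterval, ∫⁻ z,
          F (Fin.snoc (α := fun _ => Record 𝓨 M K) (Γ.history ω n)
            (Γ.select n (Γ.history ω n, u), z))
          ∂obsLaw f g m (Γ.select n (Γ.history ω n, u)) ∂volume ∂law f g m := by
  set P : Measure (ℕ → unitInterval) :=
    Measure.infinitePi fun _ : ℕ => (volume : Measure unitInterval) with hP
  set ν : Measure (Fin M → 𝓨) := Measure.pi fun k : Fin M => if k = m then g else f with hν
  have hlaw : law f g m = P.prod (Measure.infinitePi fun _ : ℕ => ν) := rfl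
  have hsel : Measurable fun p : SampleSpace 𝓨 M × unitInterval =>
      Γ.select n (Γ.history p.1 n, p.2) :=
    (Γ.measurable_select n).comp
      (((Γ.measurable_history n).comp measurable_fst).prodMk measurable_snd)
  have hJ : Measurable fun p : (SampleSpace 𝓨 M × unitInterval) × (Fin M → 𝓨) =>
      F (Fin.snoc (α := fun _ => Record 𝓨 M K) (Γ.history p.1.1 n)
        (Γ.select n (Γ.history p.1.1 n, p.1.2),
          fun i => p.2 ((Γ.select n (Γ.history p.1.1 n, p.1.2)).1 i))) :=
    hF.comp ((measurable_snoc n).comp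
      (((Γ.measurable_history n).comp (measurable_fst.comp measurable_fst)).prodMk
        ((hsel.comp measurable_fst).prodMk
          (measurable_observe.comp ((hsel.comp measurable_fst).prodMk measurable_snd)))))
  have hG : Measurable fun ω => F (Γ.history ω (n + 1)) := hF.comp (Γ.measurable_history _)
  have hinner : ∀ ω : SampleSpace 𝓨 M, ∀ u : unitInterval,
      ∫⁻ z, F (Fin.snoc (α := fun _ => Record 𝓨 M K) (Γ.history ω n)
          (Γ.select n (Γ.history ω n, u), z)) ∂obsLaw f g m (Γ.select n (Γ.history ω n, u))
      = ∫⁻ y, F (Fin.snoc (α := fun _ => Record 𝓨 M K) (Γ.history ω n)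
          (Γ.select n (Γ.history ω n, u),
            fun i => y ((Γ.select n (Γ.history ω n, u)).1 i))) ∂ν := by
    intro ω u
    exact lintegral_obsLaw f g m _ (hF.comp ((measurable_snoc n).comp
      (measurable_const.prodMk (measurable_const.prodMk measurable_id))))
  simp only [hinner]
  have hI : Measurable fun p : SampleSpace 𝓨 M × unitInterval =>
      ∫⁻ y, F (Fin.snoc (α := fun _ => Record 𝓨 M K) (Γ.history p.1 n)
        (Γ.select n (Γ.history p.1 n, p.2),
          fun i => y ((Γ.select n (Γ.history p.1 n, p.2)).1 i))) ∂ν :=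
    hJ.lintegral_prod_right'
  rw [hlaw, lintegral_prod _ hG.aemeasurable,
    lintegral_prod _ hI.lintegral_prod_right'.aemeasurable]
  have hGl : Measurable fun x => ∫⁻ y, F (Γ.history (x, y) (n + 1))
      ∂Measure.infinitePi fun _ : ℕ => ν := hG.lintegral_prod_right'
  rw [hP, lintegral_infinitePi_update (fun _ => (volume : Measure unitInterval)) n hGl]
  refine lintegral_congr fun x => ?_
  -- the observations of step `n + 1` are resampled as well; the history up to `n` is not affected
  have hstep : ∀ u : unitInterval,
      ∫⁻ y, F (Γ.history (Function.update x n u, y) (n + 1)) ∂(Measure.infinitePi fun _ : ℕ => ν)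
      = ∫⁻ y, ∫⁻ b, F (Fin.snoc (α := fun _ => Record 𝓨 M K) (Γ.history (x, y) n)
          (Γ.select n (Γ.history (x, y) n, u),
            fun i => b ((Γ.select n (Γ.history (x, y) n, u)).1 i))) ∂ν
          ∂(Measure.infinitePi fun _ : ℕ => ν) := by
    intro u
    rw [lintegral_infinitePi_update (fun _ : ℕ => ν) n
      (F := fun y => F (Γ.history (Function.update x n u, y) (n + 1)))
      (hG.comp (measurable_const.prodMk measurable_id))]
    refine lintegral_congr fun y => lintegral_congr fun b => ?_
    simp only [history_succ]
    rw [Γ.history_update (x, y) n u b]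
    simp
  simp only [hstep]
  refine lintegral_lintegral_swap ?_
  exact (hI.comp (f := fun p : unitInterval × (ℕ → Fin M → 𝓨) => ((x, p.2), p.1))
    (by fun_prop)).aemeasurable

/-- If the conditional expectation of `F` given the past is at most `G`, then the same holds on
average. -/
lemma lintegral_history_succ_le (f g : Measure 𝓨) [IsProbabilityMeasure f]
    [IsProbabilityMeasure g] (m : Fin M) (n : ℕ) {F : History 𝓨 M K (n + 1) → ℝ≥0∞}
    (hF : Measurable F) {G : History 𝓨 M K n → ℝ≥0∞}
    (h : ∀ h u, ∫⁻ z, F (Fin.snoc (α := fun _ => Record 𝓨 M K) h (Γ.select n (h, u), z))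
      ∂obsLaw f g m (Γ.select n (h, u)) ≤ G h) :
    ∫⁻ ω, F (Γ.history ω (n + 1)) ∂law f g m ≤ ∫⁻ ω, G (Γ.history ω n) ∂law f g m := by
  rw [lintegral_history_succ Γ f g m n hF]
  refine lintegral_mono fun ω => ?_
  calc _ ≤ ∫⁻ _ : unitInterval, G (Γ.history ω n) := lintegral_mono fun u => h _ u
    _ = _ := by simp

end Strategy

lemma sumLLR_eq_observedSum (f g : Measure 𝓨) {n : ℕ} (h : History 𝓨 M K n) (k : Fin M) :
    sumLLR f g h k = observedSum (llr g f) h k := rfl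

lemma measurable_observedSum {φ : 𝓨 → ℝ} (hφ : Measurable φ) {n : ℕ} (k : Fin M) :
    Measurable fun h : History 𝓨 M K n => observedSum φ h k := by
  refine Finset.measurable_sum _ fun t _ => Finset.measurable_sum _ fun i _ => ?_
  refine Measurable.ite ?_ (hφ.comp (by fun_prop)) measurable_const
  have hm : Measurable fun h : History 𝓨 M K n => (h t).1.1 i :=
    (measurable_pi_apply i).comp
      (measurable_subtype_coe.comp (measurable_fst.comp (measurable_pi_apply t)))
  exact hm (measurableSet_singleton k)

/-- The conditional expectation, given the past, of an exponential of observed sums factorizes over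
the cells selected. -/
lemma lintegral_exp_observedSum_snoc (f g : Measure 𝓨) [IsProbabilityMeasure f]
    [IsProbabilityMeasure g] (m : Fin M) {φ : 𝓨 → ℝ} (hφ : Measurable φ) (w : Fin M → ℝ) {n : ℕ}
    (h : History 𝓨 M K n) (a : Selection M K) :
    ∫⁻ z, ENNReal.ofReal (Real.exp (∑ k, w k * observedSum φ
        (Fin.snoc (α := fun _ => Record 𝓨 M K) h (a, z) : History 𝓨 M K (n + 1)) k))
      ∂obsLaw f g m a
    = ENNReal.ofReal (Real.exp (∑ k, w k * observedSum φ h k)) *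
      ∏ i, ∫⁻ y, ENNReal.ofReal (Real.exp (w (a.1 i) * φ y)) ∂cellLaw f g m (a.1 i) := by
  simp only [sum_mul_observedSum_snoc, Real.exp_add, Real.exp_sum]
  simp only [ENNReal.ofReal_mul (Finset.prod_nonneg fun _ _ => (Real.exp_pos _).le),
    ENNReal.ofReal_prod_of_nonneg fun _ _ => (Real.exp_pos _).le]
  rw [lintegral_const_mul _ (by fun_prop), obsLaw]
  congr 1
  exact lintegral_pi_prod (fun i => cellLaw f g m (a.1 i))
    (F := fun i y => ENNReal.ofReal (Real.exp (w (a.1 i) * φ y))) fun i => by fun_prop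

end History

/-! ### Change of measure -/

section ChangeOfMeasure

variable {𝓨 : Type*} [MeasurableSpace 𝓨] {M K : ℕ}

/-- The exponents of `dg/df` in the density of `cellLaw f g m` with respect to
`cellLaw f g j`. -/
def shiftWeight (m j k : Fin M) : ℝ := if k = m then 1 else if k = j then -1 else 0

lemma sum_shiftWeight_mul {m j : Fin M} (hmj : m ≠ j) (S : Fin M → ℝ) :
    ∑ k, shiftWeight m j k * S k = S m - S j := by
  have h : ∀ k, shiftWeight m j k * S k
      = (if k = m then S k else 0) - (if k = j then S k else 0) := by
    intro k
    unfold shiftWeight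
    by_cases h1 : k = m
    · have : k ≠ j := h1 ▸ hmj
      simp [h1, hmj]
    · by_cases h2 : k = j
      · subst h2; simp [hmj.symm]
      · simp [h1, h2]
  simp [h, Finset.sum_sub_distrib]

lemma withDensity_exp_llr (f g : Measure 𝓨) [SigmaFinite f] [SigmaFinite g]
    (hfg : f ≪ g) (hgf : g ≪ f) :
    f.withDensity (fun y => ENNReal.ofReal (Real.exp (llr g f y))) = g := by
  have h : (fun y => ENNReal.ofReal (Real.exp (llr g f y))) =ᵐ[f] g.rnDeriv f := by
    filter_upwards [exp_llr_of_ac' g f hfg, g.rnDeriv_ne_top f] with y hy hy'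
    rw [hy, ENNReal.ofReal_toReal hy']
  rw [withDensity_congr_ae h, Measure.withDensity_rnDeriv_eq _ _ hgf]

lemma withDensity_exp_neg_llr (f g : Measure 𝓨) [SigmaFinite f] [SigmaFinite g]
    (hfg : f ≪ g) (hgf : g ≪ f) :
    g.withDensity (fun y => ENNReal.ofReal (Real.exp (-llr g f y))) = f := by
  have h : (fun y => ENNReal.ofReal (Real.exp (-llr g f y)))
      =ᵐ[g] fun y => ENNReal.ofReal (Real.exp (llr f g y)) := by
    filter_upwards [neg_llr hgf] with y hy
    rw [← hy]; rfl
  rw [withDensity_congr_ae h, withDensity_exp_llr g f hgf hfg]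

variable (f g : Measure 𝓨) [IsProbabilityMeasure f] [IsProbabilityMeasure g]

lemma cellLaw_withDensity (hfg : f ≪ g) (hgf : g ≪ f) {m j : Fin M} (hmj : m ≠ j) (k : Fin M) :
    (cellLaw f g j k).withDensity
      (fun y => ENNReal.ofReal (Real.exp (shiftWeight m j k * llr g f y))) = cellLaw f g m k := by
  unfold cellLaw shiftWeight
  by_cases h1 : k = m
  · have : k ≠ j := h1 ▸ hmj
    simp [h1, hmj, withDensity_exp_llr f g hfg hgf]
  · by_cases h2 : k = j
    · have : j ≠ m := hmj.symm
      simp [h2, this, withDensity_exp_neg_llr f g hfg hgf]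
    · simp [h1, h2, show (fun _ : 𝓨 => (1 : ℝ≥0∞)) = 1 from rfl]

lemma obsLaw_withDensity (hfg : f ≪ g) (hgf : g ≪ f) {m j : Fin M} (hmj : m ≠ j)
    (a : Selection M K) :
    (obsLaw f g j a).withDensity (fun z => ∏ i,
      ENNReal.ofReal (Real.exp (shiftWeight m j (a.1 i) * llr g f (z i)))) = obsLaw f g m a := by
  have hX : Measurable (llr g f) := measurable_llr g f
  symm
  refine Measure.pi_eq fun s hs => ?_
  rw [withDensity_apply _ (MeasurableSet.univ_pi hs),
    ← lintegral_indicator (MeasurableSet.univ_pi hs)]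
  have hind : ∀ z : Fin K → 𝓨, (Set.univ.pi s).indicator (fun z => ∏ i,
      ENNReal.ofReal (Real.exp (shiftWeight m j (a.1 i) * llr g f (z i)))) z
      = ∏ i, (s i).indicator (fun y => ENNReal.ofReal
          (Real.exp (shiftWeight m j (a.1 i) * llr g f y))) (z i) := by
    intro z
    by_cases hz : z ∈ Set.univ.pi s
    · rw [Set.indicator_of_mem hz]
      exact Finset.prod_congr rfl fun i _ => by rw [Set.indicator_of_mem (hz i trivial)]
    · rw [Set.indicator_of_notMem hz]
      simp only [Set.mem_pi, Set.mem_univ, true_implies, not_forall] at hz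
      obtain ⟨i, hi⟩ := hz
      exact (Finset.prod_eq_zero (Finset.mem_univ i) (Set.indicator_of_notMem hi _)).symm
  simp only [hind]
  unfold obsLaw
  rw [lintegral_pi_prod (fun i => cellLaw f g j (a.1 i))
    (F := fun i => (s i).indicator fun y => ENNReal.ofReal
      (Real.exp (shiftWeight m j (a.1 i) * llr g f y)))
    fun i => Measurable.indicator (by fun_prop) (hs i)]
  refine Finset.prod_congr rfl fun i _ => ?_
  rw [lintegral_indicator (hs i), ← withDensity_apply _ (hs i), cellLaw_withDensity f g hfg hgf hmj]

/-- The likelihood ratio of the observed history under two positions of the target is the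
exponential of the difference of the two sums of log-likelihood ratios, whatever the
strategy. -/
lemma lintegral_history_change (hfg : f ≪ g) (hgf : g ≪ f) {m j : Fin M} (hmj : m ≠ j)
    (Γ : Strategy 𝓨 M K) (n : ℕ) {F : History 𝓨 M K n → ℝ≥0∞} (hF : Measurable F) :
    ∫⁻ ω, F (Γ.history ω n) ∂law f g m
      = ∫⁻ ω, F (Γ.history ω n) * ENNReal.ofReal (Real.exp
          (sumLLR f g (Γ.history ω n) m - sumLLR f g (Γ.history ω n) j)) ∂law f g j := by
  have hX : Measurable (llr g f) := measurable_llr g f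
  induction n with
  | zero =>
    have h0 : ∀ ω, Γ.history ω 0 = Fin.elim0 := fun ω => rfl
    simp [h0, sumLLR]
  | succ n ih =>
    have hF' : Measurable fun h : History 𝓨 M K (n + 1) =>
        F h * ENNReal.ofReal (Real.exp (sumLLR f g h m - sumLLR f g h j)) :=
      hF.mul (((measurable_sumLLR f g m).sub (measurable_sumLLR f g j)).exp.ennreal_ofReal)
    rw [Γ.lintegral_history_succ f g m n hF, Γ.lintegral_history_succ f g j n hF',
      ih (Γ.measurable_lintegral_step f g m n hF)]
    refine lintegral_congr fun ω => ?_
    rw [← lintegral_mul_const']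
    swap; · exact ENNReal.ofReal_ne_top
    refine lintegral_congr fun u => ?_
    set h := Γ.history ω n
    set a := Γ.select n (h, u)
    have hFz : Measurable fun z : Fin K → 𝓨 =>
        F (Fin.snoc (α := fun _ => Record 𝓨 M K) h (a, z)) :=
      hF.comp ((measurable_snoc n).comp
        (measurable_const.prodMk (measurable_const.prodMk measurable_id)))
    rw [← obsLaw_withDensity f g hfg hgf hmj a, lintegral_withDensity_eq_lintegral_mul _
      (Finset.measurable_prod _ fun i _ => by fun_prop) hFz,
      ← lintegral_mul_const' _ _ ENNReal.ofReal_ne_top]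
    refine lintegral_congr fun z => ?_
    simp only [sumLLR_eq_observedSum, Pi.mul_apply]
    rw [← sum_shiftWeight_mul hmj, ← sum_shiftWeight_mul hmj, sum_mul_observedSum_snoc,
      Real.exp_add, ENNReal.ofReal_mul (Real.exp_pos _).le, Real.exp_sum Finset.univ
        (fun i => shiftWeight m j (a.1 i) * llr g f (z i)),
      ENNReal.ofReal_prod_of_nonneg fun _ _ => (Real.exp_pos _).le]
    ring

lemma measure_history_mem_le (hfg : f ≪ g) (hgf : g ≪ f) {m j : Fin M} (hmj : m ≠ j)
    (Γ : Strategy 𝓨 M K) (n : ℕ) {A : Set (History 𝓨 M K n)} (hA : MeasurableSet A) {x : ℝ}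
    (hx : ∀ h ∈ A, sumLLR f g h m - sumLLR f g h j ≤ x) :
    law f g m {ω | Γ.history ω n ∈ A}
      ≤ ENNReal.ofReal (Real.exp x) * law f g j {ω | Γ.history ω n ∈ A} := by
  have hmeas : MeasurableSet {ω | Γ.history ω n ∈ A} := Γ.measurable_history n hA
  have h := lintegral_history_change f g hfg hgf hmj Γ n
    (F := A.indicator 1) (measurable_one.indicator hA)
  have h1 : ∀ ω, A.indicator (1 : History 𝓨 M K n → ℝ≥0∞) (Γ.history ω n)
      = {ω | Γ.history ω n ∈ A}.indicator 1 ω := fun ω => rfl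
  simp only [h1] at h
  rw [lintegral_indicator_one hmeas] at h
  rw [h, ← lintegral_indicator_one hmeas, ← lintegral_const_mul' _ _ ENNReal.ofReal_ne_top]
  refine lintegral_mono fun ω => ?_
  by_cases hω : Γ.history ω n ∈ A
  · rw [Set.indicator_of_mem (show ω ∈ {ω | Γ.history ω n ∈ A} from hω)]
    simpa using ENNReal.ofReal_le_ofReal (Real.exp_le_exp.2 (hx _ hω))
  · rw [Set.indicator_of_notMem (show ω ∉ {ω | Γ.history ω n ∈ A} from hω)]
    simp

end ChangeOfMeasure

/-! ### Stopping times -/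

section Stopping

variable {𝓨 : Type*} [MeasurableSpace 𝓨] {M K : ℕ}

namespace Strategy

variable (Γ : Strategy 𝓨 M K)

/-- The histories of length `n` at which the strategy stops at time `n` and not before. -/
def stopAt (n : ℕ) : Set (History 𝓨 M K n) :=
  {h | h ∈ Γ.stopSet n ∧ ∀ (t : ℕ) (ht : t < n), (fun i => h (Fin.castLE ht.le i)) ∉ Γ.stopSet t}

lemma measurableSet_stopAt (n : ℕ) : MeasurableSet (Γ.stopAt n) := by
  have : Γ.stopAt n = Γ.stopSet n ∩ ⋂ (t : ℕ) (ht : t < n),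
      (fun (h : History 𝓨 M K n) i => h (Fin.castLE ht.le i)) ⁻¹' (Γ.stopSet t)ᶜ := by
    ext h; simp [stopAt]
  rw [this]
  refine (Γ.measurableSet_stopSet n).inter (.iInter fun t => .iInter fun ht => ?_)
  exact (measurable_pi_iff.2 fun i => measurable_pi_apply _) (Γ.measurableSet_stopSet t).compl

lemma lt_stopTime_iff (ω : SampleSpace 𝓨 M) (n : ℕ) :
    (n : ℕ∞) < Γ.stopTime ω ↔ ∀ t ≤ n, Γ.history ω t ∉ Γ.stopSet t := by
  constructor
  · intro h t ht hmem
    exact absurd (h.trans_le (iInf₂_le t hmem)) (by simpa using ht)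
  · intro h
    have h1 : ((n + 1 : ℕ) : ℕ∞) ≤ Γ.stopTime ω := by
      refine le_iInf₂ fun t ht => ?_
      by_contra hlt
      rw [not_le, Nat.cast_lt] at hlt
      exact h t (by omega) ht
    exact lt_of_lt_of_le (by exact_mod_cast Nat.lt_succ_self n) h1

lemma stopTime_eq_iff (ω : SampleSpace 𝓨 M) (n : ℕ) :
    Γ.stopTime ω = n ↔ Γ.history ω n ∈ Γ.stopAt n := by
  have hpre : ∀ t (ht : t < n), (fun i => Γ.history ω n (Fin.castLE ht.le i)) = Γ.history ω t :=
    fun t ht => funext fun i => Γ.history_apply_castLE ω ht.le i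
  have hmem : Γ.history ω n ∈ Γ.stopAt n ↔
      Γ.history ω n ∈ Γ.stopSet n ∧ ∀ t < n, Γ.history ω t ∉ Γ.stopSet t := by
    simp only [stopAt, Set.mem_ofPred_eq]
    exact and_congr Iff.rfl (forall₂_congr fun t ht => by rw [hpre t ht])
  rw [hmem]
  constructor
  · intro h
    have h2 : ∀ t < n, Γ.history ω t ∉ Γ.stopSet t := by
      intro t ht
      refine (Γ.lt_stopTime_iff ω t).1 ?_ t le_rfl
      rw [h]; exact_mod_cast ht
    refine ⟨?_, h2⟩
    by_contra hn
    have := (Γ.lt_stopTime_iff ω n).2 fun t ht => by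
      rcases ht.lt_or_eq with h' | rfl
      exacts [h2 t h', hn]
    exact absurd h this.ne'
  · rintro ⟨h1, h2⟩
    refine le_antisymm (iInf₂_le n h1) (le_iInf₂ fun t ht => ?_)
    by_contra hlt
    rw [not_le, Nat.cast_lt] at hlt
    exact h2 t hlt ht

/-- Wald's likelihood ratio inequality: declaring `l` at a moment when the log-likelihood ratio of
`m` against `j` is at most `x` is at most `exp x` times as likely under `m` as under `j`. -/
lemma measure_declares_sumLLR_le (f g : Measure 𝓨) [IsProbabilityMeasure f]
    [IsProbabilityMeasure g] (hfg : f ≪ g) (hgf : g ≪ f) {m j : Fin M} (hmj : m ≠ j) (l : Fin M)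
    (x : ℝ) :
    law f g m {ω | ∃ n : ℕ, Γ.stopTime ω = n ∧ Γ.decide n (Γ.history ω n) = l ∧
        sumLLR f g (Γ.history ω n) m - sumLLR f g (Γ.history ω n) j ≤ x}
      ≤ ENNReal.ofReal (Real.exp x) * law f g j (Γ.declares l) := by
  set A : ∀ n, Set (History 𝓨 M K n) := fun n =>
    (Γ.stopAt n ∩ Γ.decide n ⁻¹' {l}) ∩ {h | sumLLR f g h m - sumLLR f g h j ≤ x} with hA
  have hAm : ∀ n, MeasurableSet (A n) := fun n =>
    ((Γ.measurableSet_stopAt n).inter (Γ.measurable_decide n (measurableSet_singleton l))).inter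
      (measurableSet_le ((measurable_sumLLR f g m).sub (measurable_sumLLR f g j)) measurable_const)
  have hset : {ω | ∃ n : ℕ, Γ.stopTime ω = n ∧ Γ.decide n (Γ.history ω n) = l ∧
        sumLLR f g (Γ.history ω n) m - sumLLR f g (Γ.history ω n) j ≤ x}
      = ⋃ n, {ω | Γ.history ω n ∈ A n} := by
    ext ω; simp [hA, stopTime_eq_iff, and_assoc]
  rw [hset]
  have hdisj : Pairwise (Function.onFun Disjoint fun n => {ω | Γ.history ω n ∈ A n}) := by
    intro n n' hnn'
    refine Set.disjoint_left.2 fun ω h1 h2 => hnn' ?_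
    have e1 := (Γ.stopTime_eq_iff ω n).2 h1.1.1
    have e2 := (Γ.stopTime_eq_iff ω n').2 h2.1.1
    exact_mod_cast e1.symm.trans e2
  calc law f g m (⋃ n, {ω | Γ.history ω n ∈ A n})
      ≤ ∑' n, law f g m {ω | Γ.history ω n ∈ A n} := measure_iUnion_le _
    _ ≤ ∑' n, ENNReal.ofReal (Real.exp x) * law f g j {ω | Γ.history ω n ∈ A n} :=
        ENNReal.tsum_le_tsum fun n =>
          measure_history_mem_le f g hfg hgf hmj Γ n (hAm n) fun h hh => hh.2
    _ = ENNReal.ofReal (Real.exp x) * law f g j (⋃ n, {ω | Γ.history ω n ∈ A n}) := by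
        rw [ENNReal.tsum_mul_left, measure_iUnion hdisj fun n => Γ.measurable_history n (hAm n)]
    _ ≤ _ := by
        gcongr
        refine Set.iUnion_subset fun n ω hω => ?_
        exact ⟨n, (Γ.stopTime_eq_iff ω n).2 hω.1.1, hω.1.2⟩

/-- `E τ = ∑ P(τ > n)`, with the event `τ > n` enlarged to not being in `stopSet n` at time
`n`. -/
lemma expectedTime_le (f g : Measure 𝓨) [IsProbabilityMeasure f] [IsProbabilityMeasure g]
    (m : Fin M) : Γ.expectedTime f g m ≤ ∑' n, law f g m {ω | Γ.history ω n ∉ Γ.stopSet n} := by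
  have hm : ∀ n, MeasurableSet {ω | Γ.history ω n ∉ Γ.stopSet n} := fun n =>
    Γ.measurable_history n (Γ.measurableSet_stopSet n).compl
  calc Γ.expectedTime f g m
      ≤ ∫⁻ ω, ∑' n, {ω | Γ.history ω n ∉ Γ.stopSet n}.indicator 1 ω ∂law f g m := by
        refine lintegral_mono fun ω => ?_
        have key : ∀ N : ℕ, (N : ℕ∞) ≤ Γ.stopTime ω → (N : ℝ≥0∞) ≤
            ∑' n, {ω | Γ.history ω n ∉ Γ.stopSet n}.indicator (1 : SampleSpace 𝓨 M → ℝ≥0∞) ω := by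
          intro N hN
          calc (N : ℝ≥0∞) = ∑ n ∈ Finset.range N, (1 : ℝ≥0∞) := by simp
            _ = ∑ n ∈ Finset.range N, {ω | Γ.history ω n ∉ Γ.stopSet n}.indicator 1 ω := by
              refine Finset.sum_congr rfl fun n hn => ?_
              have hlt : (n : ℕ∞) < Γ.stopTime ω :=
                lt_of_lt_of_le (by exact_mod_cast Finset.mem_range.1 hn) hN
              rw [Set.indicator_of_mem]
              · rfl
              · exact (Γ.lt_stopTime_iff ω n).1 hlt n le_rfl
            _ ≤ _ := ENNReal.sum_le_tsum _
        rcases eq_or_ne (Γ.stopTime ω) ⊤ with h | h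
        · rw [h, ENat.toENNReal_top, top_le_iff]
          refine ENNReal.eq_top_of_forall_nnreal_le fun r => ?_
          obtain ⟨N, hN⟩ := exists_nat_ge r
          exact le_trans (by simpa using ENNReal.coe_le_coe.2 hN) (key N (by rw [h]; exact le_top))
        · obtain ⟨N, hN⟩ := ENat.ne_top_iff_exists.1 h
          rw [← hN]
          simpa using key N hN.le
    _ = _ := by
        rw [lintegral_tsum fun n => (measurable_one.indicator (hm n)).aemeasurable]
        simp only [lintegral_indicator_one (hm _)]

end Strategy

end Stopping

/-! ### A maximal weak law of large numbers, uniform in the strategy -/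

section WeakLaw

/-- A centred integrable function is the sum of a bounded centred one and of one with small
`L¹` norm. -/
lemma exists_bounded_centred_approx {𝓨 : Type*} [MeasurableSpace 𝓨] (μ : Measure 𝓨)
    [IsProbabilityMeasure μ] {ξ : 𝓨 → ℝ} (hξi : Integrable ξ μ) (hξ0 : ∫ y, ξ y ∂μ = 0) {ε : ℝ}
    (hε : 0 < ε) :
    ∃ φ : 𝓨 → ℝ, Measurable φ ∧ (∃ B, 0 < B ∧ ∀ y, |φ y| ≤ B) ∧ ∫ y, φ y ∂μ = 0 ∧
      ∫⁻ y, ENNReal.ofReal |ξ y - φ y| ∂μ ≤ ENNReal.ofReal ε := by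
  obtain ⟨s, hs, hsL⟩ := (memLp_one_iff_integrable.2 hξi).exists_simpleFunc_eLpNorm_sub_lt
    ENNReal.one_ne_top (ε := ENNReal.ofReal (ε / 2)) (by simpa using half_pos hε)
  have hsi : Integrable s μ := memLp_one_iff_integrable.1 hsL
  have hd : Integrable (fun y => ξ y - s y) μ := hξi.sub hsi
  have hs' : ∫ y, |ξ y - s y| ∂μ < ε / 2 := by
    rw [eLpNorm_one_eq_lintegral_enorm] at hs
    have h1 : ENNReal.ofReal (∫ y, |ξ y - s y| ∂μ) = ∫⁻ y, ‖(ξ - s) y‖ₑ ∂μ :=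
      ofReal_integral_norm_eq_lintegral_enorm hd
    rw [← h1] at hs
    exact (ENNReal.ofReal_lt_ofReal_iff (half_pos hε)).1 hs
  set c := ∫ y, s y ∂μ with hc
  have hc' : |c| < ε / 2 := by
    have h2 : c = -∫ y, (ξ y - s y) ∂μ := by rw [integral_sub hξi hsi, hξ0]; simp [hc]
    rw [h2, abs_neg]
    exact (abs_integral_le_integral_abs).trans_lt hs'
  obtain ⟨C, hC⟩ := s.exists_forall_norm_le
  refine ⟨fun y => s y - c, s.measurable.sub_const c, ⟨|C| + |c| + 1, by positivity, fun y => ?_⟩,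
    ?_, ?_⟩
  · have h3 := hC y
    rw [Real.norm_eq_abs] at h3
    have h4 := abs_sub (s y) c
    have h5 := le_abs_self C
    linarith
  · rw [integral_sub hsi (integrable_const c)]; simp [hc]
  · have hi : Integrable (fun y => |ξ y - (s y - c)|) μ :=
      (hξi.sub (hsi.sub (integrable_const c))).abs
    rw [← ofReal_integral_eq_lintegral_ofReal hi (ae_of_all _ fun y => abs_nonneg _)]
    refine ENNReal.ofReal_le_ofReal ?_
    calc ∫ y, |ξ y - (s y - c)| ∂μ ≤ ∫ y, (|ξ y - s y| + |c|) ∂μ := by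
          refine integral_mono hi (hd.abs.add (integrable_const _)) fun y => ?_
          have : ξ y - (s y - c) = (ξ y - s y) + c := by ring
          rw [this]; exact abs_add_le _ _
      _ = ∫ y, |ξ y - s y| ∂μ + |c| := by
          rw [integral_add hd.abs (integrable_const _)]; simp
      _ ≤ ε := by linarith

variable {𝓨 : Type*} [MeasurableSpace 𝓨] {M K : ℕ} (f g : Measure 𝓨) [IsProbabilityMeasure f]
  [IsProbabilityMeasure g]

/-- Hoeffding's bound for the moment generating function of an observed sum. -/
lemma lintegral_exp_observedSum_le (m k : Fin M) {φ : 𝓨 → ℝ} (hφ : Measurable φ) {B : ℝ}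
    (hB : 0 < B) (hb : ∀ y, |φ y| ≤ B) (h0 : ∫ y, φ y ∂cellLaw f g m k = 0)
    (Γ : Strategy 𝓨 M K) (s : ℝ) (n : ℕ) :
    ∫⁻ ω, ENNReal.ofReal (Real.exp (s * observedSum φ (Γ.history ω n) k)) ∂law f g m
      ≤ ENNReal.ofReal (Real.exp (n * (B ^ 2 * s ^ 2 / 2))) := by
  have hw : ∀ {n : ℕ} (h : History 𝓨 M K n), s * observedSum φ h k
      = ∑ k', (if k' = k then s else 0) * observedSum φ h k' := by
    intro n h; simp
  have hsub := ProbabilityTheory.hasSubgaussianMGF_of_mem_Icc_of_integral_eq_zero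
    (μ := cellLaw f g m k) (a := -B) (b := B) hφ.aemeasurable
    (ae_of_all _ fun y => abs_le.1 (hb y)) h0
  have hone : ∫⁻ y, ENNReal.ofReal (Real.exp (s * φ y)) ∂cellLaw f g m k
      ≤ ENNReal.ofReal (Real.exp (B ^ 2 * s ^ 2 / 2)) := by
    rw [← ofReal_integral_eq_lintegral_ofReal (hsub.integrable_exp_mul s)
      (ae_of_all _ fun y => (Real.exp_pos _).le)]
    refine ENNReal.ofReal_le_ofReal ((hsub.mgf_le s).trans (le_of_eq ?_))
    congr 3
    have : B - -B = 2 * B := by ring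
    simp [this, abs_of_pos hB]
  induction n with
  | zero => simp [observedSum_zero]
  | succ n ih =>
    have hm : Measurable fun h : History 𝓨 M K (n + 1) =>
        ENNReal.ofReal (Real.exp (s * observedSum φ h k)) :=
      ((measurable_observedSum hφ k).const_mul s).exp.ennreal_ofReal
    have hstep := Γ.lintegral_history_succ_le f g m n hm
      (G := fun h => ENNReal.ofReal (Real.exp (s * observedSum φ h k)) *
        ENNReal.ofReal (Real.exp (B ^ 2 * s ^ 2 / 2))) ?_
    · refine hstep.trans ?_
      rw [lintegral_mul_const' _ _ ENNReal.ofReal_ne_top]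
      refine (mul_le_mul_left ih _).trans (le_of_eq ?_)
      rw [← ENNReal.ofReal_mul (Real.exp_pos _).le, ← Real.exp_add]
      push_cast; ring_nf
    · intro h u
      simp only [hw]
      rw [lintegral_exp_observedSum_snoc f g m hφ]
      gcongr
      set a := Γ.select n (h, u)
      by_cases hk : ∃ i, a.1 i = k
      · obtain ⟨i, hi⟩ := hk
        rw [Finset.prod_eq_single i]
        · simpa [hi] using hone
        · intro i' _ hne
          have : a.1 i' ≠ k := fun h' => hne (a.2 (h'.trans hi.symm))
          simp [this]
        · simp
      · push Not at hk
        simp only [hk, if_false, zero_mul, Real.exp_zero, ENNReal.ofReal_one, lintegral_const,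
          measure_univ, mul_one, Finset.prod_const_one]
        rw [← ENNReal.ofReal_one]
        exact ENNReal.ofReal_le_ofReal (Real.one_le_exp (by positivity))

lemma measure_le_observedSum_le (m k : Fin M) {φ : 𝓨 → ℝ} (hφ : Measurable φ) {B : ℝ}
    (hB : 0 < B) (hb : ∀ y, |φ y| ≤ B) (h0 : ∫ y, φ y ∂cellLaw f g m k = 0)
    (Γ : Strategy 𝓨 M K) {δ : ℝ} (hδ : 0 < δ) {t n : ℕ} (htn : t ≤ n) :
    law f g m {ω | δ * n ≤ |observedSum φ (Γ.history ω t) k|}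
      ≤ ENNReal.ofReal (2 * Real.exp (-(δ ^ 2 / (2 * B ^ 2)) * n)) := by
  have hside : ∀ σ : ℝ, |σ| = 1 →
      law f g m {ω | δ * n ≤ σ * observedSum φ (Γ.history ω t) k}
        ≤ ENNReal.ofReal (Real.exp (-(δ ^ 2 / (2 * B ^ 2)) * n)) := by
    intro σ hσ
    have hσ2 : σ ^ 2 = 1 := by rw [← sq_abs, hσ, one_pow]
    -- the optimal exponent in Chernoff's bound
    set s := δ / B ^ 2 with hs
    have hspos : 0 < s := by positivity
    have hE := lintegral_exp_observedSum_le f g m k hφ hB hb h0 Γ (s * σ) t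
    have hsub : {ω | δ * n ≤ σ * observedSum φ (Γ.history ω t) k} ⊆
        {ω | ENNReal.ofReal (Real.exp (s * (δ * n))) ≤
          ENNReal.ofReal (Real.exp (s * σ * observedSum φ (Γ.history ω t) k))} := by
      intro ω hω
      refine ENNReal.ofReal_le_ofReal (Real.exp_le_exp.2 ?_)
      rw [mul_assoc]
      exact mul_le_mul_of_nonneg_left hω hspos.le
    have hm : Measurable fun ω =>
        ENNReal.ofReal (Real.exp (s * σ * observedSum φ (Γ.history ω t) k)) :=
      (((measurable_observedSum hφ k).comp (Γ.measurable_history t)).const_mul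
        (s * σ)).exp.ennreal_ofReal
    refine (measure_mono hsub).trans ((meas_ge_le_lintegral_div hm.aemeasurable
      (by simp [Real.exp_pos]) ENNReal.ofReal_ne_top).trans ?_)
    refine (ENNReal.div_le_div_right hE _).trans ?_
    rw [← ENNReal.ofReal_div_of_pos (Real.exp_pos _), ← Real.exp_sub]
    refine ENNReal.ofReal_le_ofReal (Real.exp_le_exp.2 ?_)
    have htn' : (t : ℝ) ≤ n := by exact_mod_cast htn
    have e1 : B ^ 2 * (s * σ) ^ 2 / 2 = δ ^ 2 / (2 * B ^ 2) := by
      rw [mul_pow, hσ2, hs]; field_simp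
    have e2 : s * (δ * n) = 2 * (δ ^ 2 / (2 * B ^ 2)) * n := by rw [hs]; field_simp
    rw [e1, e2]
    have : (t : ℝ) * (δ ^ 2 / (2 * B ^ 2)) ≤ n * (δ ^ 2 / (2 * B ^ 2)) :=
      mul_le_mul_of_nonneg_right htn' (by positivity)
    linarith
  have hcover : {ω | δ * n ≤ |observedSum φ (Γ.history ω t) k|} ⊆
      {ω | δ * n ≤ 1 * observedSum φ (Γ.history ω t) k} ∪
      {ω | δ * n ≤ (-1) * observedSum φ (Γ.history ω t) k} := by
    intro ω hω
    rcases le_abs.1 (show δ * n ≤ |observedSum φ (Γ.history ω t) k| from hω) with h | h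
    · left; simpa using h
    · right; simpa using h
  refine (measure_mono hcover).trans ((measure_union_le _ _).trans ?_)
  rw [two_mul, ENNReal.ofReal_add (Real.exp_pos _).le (Real.exp_pos _).le]
  exact add_le_add (hside 1 (by simp)) (hside (-1) (by simp))

lemma lintegral_observedSum_le (m k : Fin M) {ψ : 𝓨 → ℝ} (hψ : Measurable ψ) (h0 : ∀ y, 0 ≤ ψ y)
    (Γ : Strategy 𝓨 M K) (n : ℕ) :
    ∫⁻ ω, ENNReal.ofReal (observedSum ψ (Γ.history ω n) k) ∂law f g m
      ≤ n * ∫⁻ y, ENNReal.ofReal (ψ y) ∂cellLaw f g m k := by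
  have hnn : ∀ (n : ℕ) (h : History 𝓨 M K n), 0 ≤ observedSum ψ h k := fun n h =>
    Finset.sum_nonneg fun t _ => Finset.sum_nonneg fun i _ => by
      split_ifs; exacts [h0 _, le_rfl]
  induction n with
  | zero => simp [observedSum_zero]
  | succ n ih =>
    have hm : Measurable fun h : History 𝓨 M K (n + 1) => ENNReal.ofReal (observedSum ψ h k) :=
      (measurable_observedSum hψ k).ennreal_ofReal
    have hstep := Γ.lintegral_history_succ_le f g m n hm
      (G := fun h => ENNReal.ofReal (observedSum ψ h k)
        + ∫⁻ y, ENNReal.ofReal (ψ y) ∂cellLaw f g m k) ?_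
    · refine hstep.trans ?_
      rw [lintegral_add_right _ measurable_const]
      simp only [lintegral_const, measure_univ, mul_one]
      push_cast
      rw [add_mul, one_mul]
      gcongr
    · intro h u
      set a := Γ.select n (h, u)
      have hpt : ∀ z : Fin K → 𝓨, ENNReal.ofReal (observedSum ψ
          (Fin.snoc (α := fun _ => Record 𝓨 M K) h (a, z) : History 𝓨 M K (n + 1)) k)
          = ENNReal.ofReal (observedSum ψ h k)
            + ∑ i, if a.1 i = k then ENNReal.ofReal (ψ (z i)) else 0 := by
        intro z
        rw [observedSum_snoc, ENNReal.ofReal_add (hnn n h)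
          (Finset.sum_nonneg fun i _ => by split_ifs; exacts [h0 _, le_rfl]),
          ENNReal.ofReal_sum_of_nonneg fun i _ => by split_ifs; exacts [h0 _, le_rfl]]
        congr 1
        exact Finset.sum_congr rfl fun i _ => by split_ifs <;> simp
      simp only [hpt]
      rw [lintegral_add_left measurable_const]
      simp only [lintegral_const, measure_univ, mul_one]
      gcongr
      rw [lintegral_finsetSum]
      swap
      · intro i _
        split_ifs
        exacts [(hψ.comp (measurable_pi_apply i)).ennreal_ofReal, measurable_const]
      have hi : ∀ i, ∫⁻ z, (if a.1 i = k then ENNReal.ofReal (ψ (z i)) else 0) ∂obsLaw f g m a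
          = if a.1 i = k then ∫⁻ y, ENNReal.ofReal (ψ y) ∂cellLaw f g m k else 0 := by
        intro i
        split_ifs with h
        · subst h
          exact (measurePreserving_eval (fun i => cellLaw f g m (a.1 i)) i).lintegral_comp
            hψ.ennreal_ofReal
        · simp
      simp only [hi]
      by_cases hk : ∃ i, a.1 i = k
      · obtain ⟨i, hi⟩ := hk
        rw [Finset.sum_eq_single i]
        · simp [hi]
        · intro i' _ hne
          have : a.1 i' ≠ k := fun h' => hne (a.2 (h'.trans hi.symm))
          simp [this]
        · simp
      · push Not at hk
        simp [hk]

lemma abs_observedSum_le {φ : 𝓨 → ℝ} (Γ : Strategy 𝓨 M K) (ω : SampleSpace 𝓨 M) (k : Fin M)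
    {t n : ℕ} (htn : t ≤ n) : |observedSum φ (Γ.history ω t) k|
      ≤ observedSum (fun y => |φ y|) (Γ.history ω n) k := by
  have h1 : |observedSum φ (Γ.history ω t) k|
      ≤ observedSum (fun y => |φ y|) (Γ.history ω t) k := by
    refine (Finset.abs_sum_le_sum_abs _ _).trans (Finset.sum_le_sum fun s _ => ?_)
    refine (Finset.abs_sum_le_sum_abs _ _).trans (Finset.sum_le_sum fun i _ => ?_)
    split_ifs <;> simp
  refine h1.trans ?_
  induction n, htn using Nat.le_induction with
  | base => exact le_rfl
  | succ n hn ih =>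
    rw [Γ.history_succ, observedSum_snoc]
    have : (0 : ℝ) ≤ ∑ i, if (Γ.select n (Γ.history ω n, ω.1 n)).1 i = k then
        |φ (ω.2 n ((Γ.select n (Γ.history ω n, ω.1 n)).1 i))| else 0 :=
      Finset.sum_nonneg fun i _ => by split_ifs; exacts [abs_nonneg _, le_rfl]
    linarith

/-- The maximal weak law for the observed sums of a centred integrable function. The bound is
uniform over all strategies. No moment beyond the first is needed: the function is approximated
by a bounded one, to which Hoeffding's bound applies, and the rest is small in `L¹`. -/
lemma exists_forall_measure_observedSum_le (m k : Fin M) {ξ : 𝓨 → ℝ} (hξ : Measurable ξ)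
    (hξi : Integrable ξ (cellLaw f g m k)) (hξ0 : ∫ y, ξ y ∂cellLaw f g m k = 0)
    {δ p : ℝ} (hδ : 0 < δ) (hp : 0 < p) :
    ∃ n₀ : ℕ, ∀ n ≥ n₀, ∀ Γ : Strategy 𝓨 M K,
      law f g m {ω | ∃ t ≤ n, δ * n ≤ |observedSum ξ (Γ.history ω t) k|} ≤ ENNReal.ofReal p := by
  obtain ⟨φ, hφ, ⟨B, hB, hb⟩, hφ0, hε⟩ := exists_bounded_centred_approx (cellLaw f g m k) hξi hξ0
    (show 0 < p / 2 * (δ / 2) by positivity)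
  set q := (δ / 2) ^ 2 / (2 * B ^ 2) with hq
  have hqpos : 0 < q := by positivity
  have hlim : Filter.Tendsto (fun n : ℕ => ((n : ℝ) + 1) * (2 * Real.exp (-q * n)))
      Filter.atTop (𝓝 0) := by
    have h1 : Filter.Tendsto (fun x : ℝ => x * Real.exp (-q * x)) Filter.atTop (𝓝 0) := by
      simpa using tendsto_rpow_mul_exp_neg_mul_atTop_nhds_zero 1 q hqpos
    have h2 : Filter.Tendsto (fun x : ℝ => Real.exp (-q * x)) Filter.atTop (𝓝 0) := by
      simpa using tendsto_rpow_mul_exp_neg_mul_atTop_nhds_zero 0 q hqpos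
    have h3 := ((h1.add h2).const_mul 2).comp tendsto_natCast_atTop_atTop
    simp only [add_zero, mul_zero] at h3
    refine h3.congr fun n => ?_
    simp only [Function.comp]; ring
  obtain ⟨n₁, hn₁⟩ := Filter.eventually_atTop.1 (hlim.eventually_lt_const (half_pos hp))
  refine ⟨max n₁ 1, fun n hn Γ => ?_⟩
  have hnpos : (0 : ℝ) < n := by exact_mod_cast (le_max_right n₁ 1).trans hn
  have hcover : {ω | ∃ t ≤ n, δ * n ≤ |observedSum ξ (Γ.history ω t) k|} ⊆
      (⋃ t ∈ Finset.range (n + 1), {ω | δ / 2 * n ≤ |observedSum φ (Γ.history ω t) k|}) ∪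
      {ω | δ / 2 * n ≤ observedSum (fun y => |ξ y - φ y|) (Γ.history ω n) k} := by
    rintro ω ⟨t, ht, hω⟩
    by_contra hcon
    simp only [Set.mem_union, Set.mem_iUnion, not_or, not_exists, Finset.mem_range,
      Set.mem_ofPred_eq, not_le] at hcon
    have h1 := hcon.1 t (by omega)
    have h2 := (abs_observedSum_le Γ ω k ht (φ := fun y => ξ y - φ y)).trans_lt hcon.2
    have h3 : observedSum ξ (Γ.history ω t) k = observedSum φ (Γ.history ω t) k
        + observedSum (fun y => ξ y - φ y) (Γ.history ω t) k := by
      rw [← observedSum_add]; simp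
    rw [h3] at hω
    have h4 := abs_add_le (observedSum φ (Γ.history ω t) k)
      (observedSum (fun y => ξ y - φ y) (Γ.history ω t) k)
    have : δ * n = δ / 2 * n + δ / 2 * n := by ring
    linarith
  refine (measure_mono hcover).trans ((measure_union_le _ _).trans ?_)
  rw [← add_halves p, ENNReal.ofReal_add (half_pos hp).le (half_pos hp).le]
  refine add_le_add ?_ ?_
  · refine (measure_biUnion_finset_le _ _).trans ((Finset.sum_le_sum fun t ht =>
      measure_le_observedSum_le f g m k hφ hB hb hφ0 Γ (half_pos hδ)
        (Nat.lt_succ_iff.1 (Finset.mem_range.1 ht))).trans ?_)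
    rw [Finset.sum_const, Finset.card_range, nsmul_eq_mul,
      ← ENNReal.ofReal_natCast, ← ENNReal.ofReal_mul (by positivity)]
    refine ENNReal.ofReal_le_ofReal ?_
    have := hn₁ n ((le_max_left _ _).trans hn)
    push_cast
    exact this.le
  · have hψ : Measurable fun y => |ξ y - φ y| := (hξ.sub hφ).abs
    have hE := lintegral_observedSum_le f g m k hψ (fun y => abs_nonneg _) Γ n
    have hsub : {ω | δ / 2 * n ≤ observedSum (fun y => |ξ y - φ y|) (Γ.history ω n) k} ⊆
        {ω | ENNReal.ofReal (δ / 2 * n) ≤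
          ENNReal.ofReal (observedSum (fun y => |ξ y - φ y|) (Γ.history ω n) k)} :=
      fun ω hω => ENNReal.ofReal_le_ofReal hω
    have hpos : 0 < δ / 2 * n := by positivity
    refine (measure_mono hsub).trans ((meas_ge_le_lintegral_div
      ((measurable_observedSum hψ k).comp (Γ.measurable_history n)).ennreal_ofReal.aemeasurable
      (by simpa using hpos) ENNReal.ofReal_ne_top).trans ?_)
    refine ENNReal.div_le_of_le_mul (hE.trans ?_)
    refine (mul_le_mul_right hε _).trans (le_of_eq ?_)
    rw [← ENNReal.ofReal_natCast, ← ENNReal.ofReal_mul (by positivity),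
      ← ENNReal.ofReal_mul (by positivity)]
    congr 1; ring

/-- The number of times that cell `k` has been selected, as a real number. -/
def probes {𝓨 : Type*} {M K n : ℕ} (h : History 𝓨 M K n) (k : Fin M) : ℝ :=
  observedSum (fun _ => 1) h k

/-- The mean of the log-likelihood ratio of an observation of cell `k` when the target is in
cell `m`. -/
def drift (f g : Measure 𝓨) {M : ℕ} (m k : Fin M) : ℝ := if k = m then kl g f else -kl f g

variable {f g}

lemma integral_llr_eq_kl (hgf : g ≪ f) : ∫ y, llr g f y ∂g = kl g f := by
  unfold kl
  rw [toReal_klDiv_of_measure_eq hgf (by simp)]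

lemma llr_ae_eq_neg (hfg : f ≪ g) : llr g f =ᵐ[f] -llr f g := by
  exact (neg_llr hfg).symm

lemma integral_llr_eq_neg_kl (hfg : f ≪ g) : ∫ y, llr g f y ∂f = -kl f g := by
  rw [integral_congr_ae (llr_ae_eq_neg hfg), ← integral_llr_eq_kl hfg]
  simp [integral_neg]

/-- With high probability the observed sums stay close to their compensators, uniformly over the
time, the cells, and the strategy. -/
lemma exists_forall_measure_sumLLR_sub_le (hDgf : klDiv g f ≠ ∞) (hDfg : klDiv f g ≠ ∞)
    (m : Fin M) {δ p : ℝ} (hδ : 0 < δ) (hp : 0 < p) :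
    ∃ n₀ : ℕ, ∀ n ≥ n₀, ∀ Γ : Strategy 𝓨 M K,
      law f g m {ω | ∃ t ≤ n, ∃ k, δ * n ≤ |sumLLR f g (Γ.history ω t) k
        - drift f g m k * probes (Γ.history ω t) k|} ≤ ENNReal.ofReal p := by
  obtain ⟨hgf, hig⟩ := klDiv_ne_top_iff.1 hDgf
  obtain ⟨hfg, hif⟩ := klDiv_ne_top_iff.1 hDfg
  have hif' : Integrable (llr g f) f := hif.neg.congr (llr_ae_eq_neg hfg).symm
  have hint : ∀ k, Integrable (llr g f) (cellLaw f g m k) := by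
    intro k; unfold cellLaw; split_ifs; exacts [hig, hif']
  have hmean : ∀ k, ∫ y, llr g f y ∂cellLaw f g m k = drift f g m k := by
    intro k; unfold cellLaw drift
    split_ifs
    exacts [integral_llr_eq_kl hgf, integral_llr_eq_neg_kl hfg]
  have hM : (0 : ℝ) < M := by exact_mod_cast Fin.pos m
  choose n₀ hn₀ using fun k : Fin M => exists_forall_measure_observedSum_le (K := K) f g m k
    (ξ := fun y => llr g f y + -drift f g m k * 1)
    ((measurable_llr g f).add_const _) ((hint k).add (integrable_const _))
    (by rw [integral_add (hint k) (integrable_const _), hmean]; simp) hδ (div_pos hp hM)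
  refine ⟨Finset.univ.sup n₀, fun n hn Γ => ?_⟩
  have hcover : {ω | ∃ t ≤ n, ∃ k, δ * n ≤ |sumLLR f g (Γ.history ω t) k
        - drift f g m k * probes (Γ.history ω t) k|} ⊆
      ⋃ k ∈ Finset.univ, {ω | ∃ t ≤ n, δ * n ≤ |observedSum
        (fun y => llr g f y + -drift f g m k * 1) (Γ.history ω t) k|} := by
    rintro ω ⟨t, ht, k, hω⟩
    simp only [Finset.mem_univ, Set.mem_iUnion, Set.iUnion_true]
    refine ⟨k, t, ht, ?_⟩
    rw [observedSum_add, observedSum_const_mul, neg_mul, ← sub_eq_add_neg]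
    exact hω
  refine (measure_mono hcover).trans ((measure_biUnion_finset_le _ _).trans
    ((Finset.sum_le_sum fun k _ => hn₀ k n
      ((Finset.le_sup (Finset.mem_univ k)).trans hn) Γ).trans ?_))
  rw [Finset.sum_const, Finset.card_univ, Fintype.card_fin, nsmul_eq_mul,
    ← ENNReal.ofReal_natCast, ← ENNReal.ofReal_mul hM.le]
  refine ENNReal.ofReal_le_ofReal (le_of_eq ?_)
  field_simp

end WeakLaw

/-! ### A geometrically decaying potential for the DGF policy -/

section Potential

variable {𝓨 : Type*} [MeasurableSpace 𝓨]

lemma exp_mul_lt {s x : ℝ} (hs0 : 0 < s) (hs1 : s < 1) (hx : x ≠ 0) :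
    Real.exp (s * x) < s * Real.exp x + (1 - s) := by
  have h := strictConvexOn_exp.2 (Set.mem_univ x) (Set.mem_univ 0) hx hs0 (sub_pos.2 hs1)
    (by ring)
  simpa using h

/-- The Chernoff coefficients of two different equivalent laws are less than one. -/
lemma lintegral_exp_mul_llr_lt_one {f g : Measure 𝓨} [IsProbabilityMeasure f]
    [IsProbabilityMeasure g] (hfg : f ≪ g) (hgf : g ≪ f) (hne : f ≠ g) {s : ℝ} (hs0 : 0 < s)
    (hs1 : s < 1) : ∫⁻ y, ENNReal.ofReal (Real.exp (s * llr g f y)) ∂f < 1 := by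
  have hX : Measurable (llr g f) := measurable_llr g f
  have hI : ∫⁻ y, ENNReal.ofReal (Real.exp (llr g f y)) ∂f = 1 := by
    have := congrArg (fun μ => μ Set.univ) (withDensity_exp_llr f g hfg hgf)
    simpa using this
  have hR : ∫⁻ y, ENNReal.ofReal (s * Real.exp (llr g f y) + (1 - s)) ∂f = 1 := by
    have : ∀ y, ENNReal.ofReal (s * Real.exp (llr g f y) + (1 - s))
        = ENNReal.ofReal s * ENNReal.ofReal (Real.exp (llr g f y)) + ENNReal.ofReal (1 - s) :=
      fun y => by
        rw [ENNReal.ofReal_add (by positivity) (by linarith), ENNReal.ofReal_mul hs0.le]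
    simp only [this]
    rw [lintegral_add_right _ measurable_const, lintegral_const_mul' _ _ ENNReal.ofReal_ne_top, hI]
    simp only [lintegral_const, measure_univ, mul_one]
    rw [← ENNReal.ofReal_add hs0.le (by linarith)]
    simp
  have hle : ∀ y, ENNReal.ofReal (Real.exp (s * llr g f y))
      ≤ ENNReal.ofReal (s * Real.exp (llr g f y) + (1 - s)) := by
    intro y
    refine ENNReal.ofReal_le_ofReal ?_
    rcases eq_or_ne (llr g f y) 0 with h | h
    · simp [h]
    · exact (exp_mul_lt hs0 hs1 h).le
  rw [← hR]
  refine lintegral_strict_mono_of_ae_le_of_frequently_ae_lt (by fun_prop) ?_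
    (ae_of_all _ hle) ?_
  · exact ((lintegral_mono hle).trans_lt (by rw [hR]; exact ENNReal.one_lt_top)).ne
  · intro hcon
    refine hne ?_
    have hz : llr g f =ᵐ[f] 0 := by
      filter_upwards [hcon] with y hy
      by_contra h
      refine hy ?_
      refine (ENNReal.ofReal_lt_ofReal_iff ?_).2 (exp_mul_lt hs0 hs1 h) |>.ne
      have := exp_mul_lt hs0 hs1 h
      exact (Real.exp_pos _).trans this
    have h1 := withDensity_exp_llr f g hfg hgf
    rw [withDensity_congr_ae (g := 1) (by filter_upwards [hz] with y hy; simp [hy]),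
      withDensity_one] at h1
    exact h1

lemma lintegral_exp_neg_mul_llr_lt_one {f g : Measure 𝓨} [IsProbabilityMeasure f]
    [IsProbabilityMeasure g] (hfg : f ≪ g) (hgf : g ≪ f) (hne : f ≠ g) {s : ℝ} (hs0 : 0 < s)
    (hs1 : s < 1) : ∫⁻ y, ENNReal.ofReal (Real.exp (-s * llr g f y)) ∂g < 1 := by
  have hX : Measurable (llr g f) := measurable_llr g f
  have h1 : ∫⁻ y, ENNReal.ofReal (Real.exp (-s * llr g f y)) ∂g
      = ∫⁻ y, ENNReal.ofReal (Real.exp ((1 - s) * llr g f y)) ∂f := by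
    have hg : ∀ μ, μ = g → ∫⁻ y, ENNReal.ofReal (Real.exp (-s * llr g f y)) ∂g
        = ∫⁻ y, ENNReal.ofReal (Real.exp (-s * llr g f y)) ∂μ := fun μ hμ => by rw [hμ]
    rw [hg _ (withDensity_exp_llr f g hfg hgf),
      lintegral_withDensity_eq_lintegral_mul _ (by fun_prop) (by fun_prop)]
    refine lintegral_congr fun y => ?_
    rw [Pi.mul_apply, ← ENNReal.ofReal_mul (Real.exp_pos _).le, ← Real.exp_add]
    congr 2; ring
  rw [h1]
  exact lintegral_exp_mul_llr_lt_one hfg hgf hne (by linarith) (by linarith)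

/-- If the terms of a sum do not increase, and those that shrink by the factor `ρ` dominate
all others, then the sum shrinks by a factor less than one. -/
lemma sum_le_mul_sum_of_dominated {ι : Type*} (T : Finset ι) (x y : ι → ℝ≥0∞) (P : ι → Prop)
    {ρ r δ : ℝ≥0∞} (hr : r + δ = 1) (hρ : ρ + T.card * δ = r) (hyx : ∀ A ∈ T, y A ≤ x A)
    (hy : ∀ A ∈ T, P A → y A ≤ ρ * x A) (hdom : ∀ A ∈ T, ∃ A' ∈ T, P A' ∧ x A ≤ x A') :
    ∑ A ∈ T, y A ≤ r * ∑ A ∈ T, x A := by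
  classical
  rw [← Finset.sum_filter_add_sum_filter_not T P, ← Finset.sum_filter_add_sum_filter_not T P]
  set sh := ∑ A ∈ T with P A, x A
  set ns := ∑ A ∈ T with ¬P A, x A
  have h1 : ∑ A ∈ T with P A, y A ≤ ρ * sh := by
    rw [Finset.mul_sum]
    refine Finset.sum_le_sum fun A hA => ?_
    rw [Finset.mem_filter] at hA
    exact hy A hA.1 hA.2
  have h2 : ∑ A ∈ T with ¬P A, y A ≤ ns :=
    Finset.sum_le_sum fun A hA => hyx A (Finset.mem_filter.1 hA).1
  have h3 : ns ≤ T.card * sh := by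
    calc ns ≤ ∑ A ∈ T with ¬P A, sh := by
          refine Finset.sum_le_sum fun A hA => ?_
          obtain ⟨A', hA', hP, hle⟩ := hdom A (Finset.mem_filter.1 hA).1
          exact hle.trans (Finset.single_le_sum (f := x) (fun _ _ => zero_le)
            (Finset.mem_filter.2 ⟨hA', hP⟩))
      _ ≤ _ := by
          rw [Finset.sum_const, nsmul_eq_mul]
          gcongr
          exact Finset.filter_subset _ _
  calc _ ≤ ρ * sh + (r + δ) * ns := by rw [hr, one_mul]; exact add_le_add h1 h2
    _ = ρ * sh + r * ns + δ * ns := by ring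
    _ ≤ ρ * sh + r * ns + δ * (T.card * sh) := by gcongr
    _ = (ρ + T.card * δ) * sh + r * ns := by ring
    _ = r * (sh + ns) := by rw [hρ]; ring

/-- The weights of the exponent `∑ k ∈ A, (S k - S m) / M` of the potential. -/
def potentialWeight {M : ℕ} (m : Fin M) (A : Finset (Fin M)) (k : Fin M) : ℝ :=
  if k = m then -((A.card : ℝ) / M) else if k ∈ A then 1 / M else 0

/-- The nonempty sets of cells that do not contain the target. -/
def nullSets {M : ℕ} (m : Fin M) : Finset (Finset (Fin M)) :=
  Finset.univ.filter fun A => A.Nonempty ∧ m ∉ A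

lemma sum_potentialWeight_mul {M : ℕ} {m : Fin M} {A : Finset (Fin M)} (hA : A ∈ nullSets m)
    (S : Fin M → ℝ) :
    ∑ k, potentialWeight m A k * S k = (∑ k ∈ A, (S k - S m)) / M := by
  have hmA : m ∉ A := (Finset.mem_filter.1 hA).2.2
  have h : ∀ k, potentialWeight m A k * S k
      = (if k = m then -((A.card : ℝ) / M) * S k else 0) + (if k ∈ A then S k / M else 0) := by
    intro k
    unfold potentialWeight
    by_cases h1 : k = m
    · subst h1; simp [hmA]
    · by_cases h2 : k ∈ A
      · simp [h1, h2]; ring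
      · simp [h1, h2]
  simp only [h, Finset.sum_add_distrib, Finset.sum_ite_eq', Finset.mem_univ, if_true,
    Finset.sum_ite_mem, Finset.univ_inter, Finset.sum_sub_distrib, Finset.sum_const,
    nsmul_eq_mul, ← Finset.sum_div]
  ring

/-- A weight `w = potentialWeight m A k` that is not zero makes the expectation of
`(dg/df) ^ w` less than one. -/
lemma lintegral_exp_potentialWeight {f g : Measure 𝓨} [IsProbabilityMeasure f]
    [IsProbabilityMeasure g] (hfg : f ≪ g) (hgf : g ≪ f) (hne : f ≠ g) {M : ℕ} {m : Fin M}
    {A : Finset (Fin M)} (hA : A ∈ nullSets m) {k : Fin M} (hk : k = m ∨ k ∈ A) :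
    ∫⁻ y, ENNReal.ofReal (Real.exp (potentialWeight m A k * llr g f y)) ∂cellLaw f g m k < 1 := by
  obtain ⟨hAne, hmA⟩ := (Finset.mem_filter.1 hA).2
  have hM : (0 : ℝ) < M := by exact_mod_cast Fin.pos m
  have hcard : A.card < M := by
    have h1 : A ⊂ Finset.univ := Finset.ssubset_univ_iff.2 fun h => hmA (h ▸ Finset.mem_univ m)
    simpa using Finset.card_lt_card h1
  have hcpos : (1 : ℝ) ≤ A.card := by exact_mod_cast hAne.card_pos
  have hcM : (A.card : ℝ) < M := by exact_mod_cast hcard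
  unfold potentialWeight cellLaw
  by_cases h1 : k = m
  · simp only [h1, if_true]
    exact lintegral_exp_neg_mul_llr_lt_one hfg hgf hne (by positivity) ((div_lt_one hM).2 hcM)
  · have h2 : k ∈ A := hk.resolve_left h1
    simp only [h1, h2, if_false, if_true]
    exact lintegral_exp_mul_llr_lt_one hfg hgf hne (by positivity)
      ((div_lt_one hM).2 (hcpos.trans_lt hcM))

variable {f g : Measure 𝓨} {M K : ℕ}

lemma Ranking.exists_cell_eq (r : Ranking f g M K) {n : ℕ} (h : History 𝓨 M K n) (k : Fin M) :
    ∃ i, r.cell n h i = k :=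
  Finite.surjective_of_injective (r.injective n h) k

/-- Among the null sets touched by the selection of the DGF policy there is one that dominates
any given one. The cell at the first selected position has rank one or two; if it is a null cell
with a sum not below that of the target, it can be added to the set, and otherwise the target
leads and this cell is the best of the null cells. -/
lemma exists_dominating_nullSet (hK : 1 ≤ K) (hKM : K ≤ M) (r : Ranking f g M K)
    (m : Fin M) {n : ℕ} (h : History 𝓨 M K n) {A : Finset (Fin M)} (hA : A ∈ nullSets m) :
    ∃ A' ∈ nullSets m, (∃ i : Fin K, r.cell n h (dgfPosition f g hKM i) = m ∨
        r.cell n h (dgfPosition f g hKM i) ∈ A') ∧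
      ∑ k ∈ A, (sumLLR f g h k - sumLLR f g h m)
        ≤ ∑ k ∈ A', (sumLLR f g h k - sumLLR f g h m) := by
  obtain ⟨hAne, hmA⟩ := (Finset.mem_filter.1 hA).2
  set p := dgfPosition f g hKM (⟨0, hK⟩ : Fin K) with hp
  have hp1 : (p : ℕ) ≤ 1 := by
    rw [hp]; unfold dgfPosition; split_ifs <;> simp
  set q := r.cell n h p with hq
  by_cases hqm : q = m
  · exact ⟨A, hA, ⟨⟨0, hK⟩, Or.inl hqm⟩, le_rfl⟩
  by_cases hS : sumLLR f g h m ≤ sumLLR f g h q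
  · refine ⟨insert q A, ?_, ⟨⟨0, hK⟩, Or.inr (Finset.mem_insert_self _ _)⟩, ?_⟩
    · refine Finset.mem_filter.2 ⟨Finset.mem_univ _, Finset.insert_nonempty _ _, ?_⟩
      simp [hmA, Ne.symm hqm]
    · refine Finset.sum_le_sum_of_subset_of_nonneg (Finset.subset_insert _ _) fun k hk hkA => ?_
      rcases Finset.mem_insert.1 hk with rfl | hk
      · linarith
      · exact absurd hk hkA
  · push Not at hS
    obtain ⟨i, hi⟩ := r.exists_cell_eq h m
    have hip : i < p := by
      by_contra hle
      have := r.antitone n h (not_lt.1 hle)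
      simp only [hi, ← hq] at this
      linarith
    have hbest : ∀ k, k ≠ m → sumLLR f g h k ≤ sumLLR f g h q := by
      intro k hk
      obtain ⟨j, hj⟩ := r.exists_cell_eq h k
      have hji : j ≠ i := by rintro rfl; exact hk (hj.symm.trans hi)
      have hpj : p ≤ j := by
        rw [Fin.le_def]
        have h1 : (i : ℕ) < p := hip
        have h2 : (j : ℕ) ≠ i := fun h' => hji (Fin.ext h')
        omega
      have := r.antitone n h hpj
      simp only [hj, ← hq] at this
      exact this
    refine ⟨{q}, Finset.mem_filter.2 ⟨Finset.mem_univ _, by simp, by simp [Ne.symm hqm]⟩,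
      ⟨⟨0, hK⟩, Or.inr (Finset.mem_singleton_self _)⟩, ?_⟩
    obtain ⟨k₀, hk₀⟩ := hAne
    have hneg : ∀ k ∈ A, sumLLR f g h k - sumLLR f g h m ≤ sumLLR f g h q - sumLLR f g h m :=
      fun k hk => by
        have := hbest k (by rintro rfl; exact hmA hk)
        linarith
    rw [Finset.sum_singleton, ← Finset.add_sum_erase _ _ hk₀]
    have h1 := hneg k₀ hk₀
    have h2 : ∑ k ∈ A.erase k₀, (sumLLR f g h k - sumLLR f g h m) ≤ 0 :=
      Finset.sum_nonpos fun k hk => by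
        have := hneg k (Finset.mem_of_mem_erase hk)
        linarith
    linarith

variable [IsProbabilityMeasure f] [IsProbabilityMeasure g]

/-- The potential of the DGF policy decays geometrically. -/
lemma exists_lintegral_potential_le (hfg : f ≪ g) (hgf : g ≪ f) (hne : f ≠ g) (hM : 2 ≤ M)
    (hK : 1 ≤ K) (hKM : K ≤ M) (r : Ranking f g M K) (m : Fin M) :
    ∃ C q : ℝ, 0 < C ∧ 0 ≤ q ∧ q < 1 ∧ ∀ (c : ℝ) (n : ℕ),
      ∫⁻ ω, ∑ A ∈ nullSets m, ENNReal.ofReal (Real.exp (∑ k, potentialWeight m A k *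
          observedSum (llr g f) ((dgf hM hKM r c).history ω n) k)) ∂law f g m
        ≤ ENNReal.ofReal (C * q ^ n) := by
  classical
  have hX : Measurable (llr g f) := measurable_llr g f
  set F : Finset (Fin M) → Fin M → ℝ≥0∞ := fun A k =>
    ∫⁻ y, ENNReal.ofReal (Real.exp (potentialWeight m A k * llr g f y)) ∂cellLaw f g m k with hF
  set ρ : ℝ≥0∞ := (nullSets m).sup fun A => (insert m A).sup (F A) with hρ
  have hρ1 : ρ < 1 := by
    rw [hρ, Finset.sup_lt_iff (by simp)]
    intro A hA
    rw [Finset.sup_lt_iff (by simp)]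
    intro k hk
    exact lintegral_exp_potentialWeight hfg hgf hne hA (Finset.mem_insert.1 hk)
  have hFρ : ∀ A ∈ nullSets m, ∀ k, (k = m ∨ k ∈ A) → F A k ≤ ρ := fun A hA k hk =>
    (Finset.le_sup (f := F A) (Finset.mem_insert.2 hk)).trans
      (Finset.le_sup (f := fun A => (insert m A).sup (F A)) hA)
  have hF1 : ∀ A ∈ nullSets m, ∀ k, F A k ≤ 1 := by
    intro A hA k
    by_cases hk : k = m ∨ k ∈ A
    · exact (hFρ A hA k hk).trans hρ1.le
    · push Not at hk
      have : potentialWeight m A k = 0 := by simp [potentialWeight, hk.1, hk.2]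
      simp [hF, this]
  set N : ℝ := ((nullSets m).card : ℝ) with hN
  have hN0 : 0 ≤ N := Nat.cast_nonneg _
  set ρ' := ρ.toReal with hρ'
  have hρ'0 : 0 ≤ ρ' := ENNReal.toReal_nonneg
  have hρ'1 : ρ' < 1 := by
    have := (ENNReal.toReal_lt_toReal hρ1.ne_top ENNReal.one_ne_top).2 hρ1
    simpa using this
  -- the solution of `ρ' + N * δ = 1 - δ`
  set δ := (1 - ρ') / (1 + N) with hδ
  have hδ0 : 0 < δ := div_pos (by linarith) (by linarith)
  have hδe : δ * (1 + N) = 1 - ρ' := by rw [hδ]; field_simp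
  set q := 1 - δ with hq
  have hq' : ρ' + N * δ = q := by rw [hq]; linarith
  have hq0 : 0 ≤ q := by rw [← hq']; positivity
  have hqδ : ENNReal.ofReal q + ENNReal.ofReal δ = 1 := by
    rw [← ENNReal.ofReal_add hq0 hδ0.le, hq]; simp
  have hρq : ρ + (nullSets m).card * ENNReal.ofReal δ = ENNReal.ofReal q := by
    rw [← hq', ENNReal.ofReal_add hρ'0 (by positivity), hρ',
      ENNReal.ofReal_toReal hρ1.ne_top, ENNReal.ofReal_mul hN0, hN, ENNReal.ofReal_natCast]
  refine ⟨N + 1, q, by linarith, hq0, by linarith, fun c n => ?_⟩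
  set Γ := dgf hM hKM r c with hΓ
  have hterm : ∀ n A, Measurable fun h : History 𝓨 M K n => ENNReal.ofReal (Real.exp
      (∑ k, potentialWeight m A k * observedSum (llr g f) h k)) := fun n A =>
    (Finset.measurable_sum _ fun k _ =>
      (measurable_observedSum hX k).const_mul _).exp.ennreal_ofReal
  induction n with
  | zero =>
    simp only [observedSum_zero, mul_zero, Finset.sum_const_zero, Real.exp_zero,
      ENNReal.ofReal_one, Finset.sum_const, nsmul_eq_mul, mul_one, lintegral_const, measure_univ,
      pow_zero]
    rw [← ENNReal.ofReal_natCast]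
    exact ENNReal.ofReal_le_ofReal (by linarith)
  | succ n ih =>
    have hstep := Γ.lintegral_history_succ_le f g m n
      (F := fun h => ∑ A ∈ nullSets m, ENNReal.ofReal (Real.exp
        (∑ k, potentialWeight m A k * observedSum (llr g f) h k)))
      (Finset.measurable_sum _ fun A _ => hterm _ A)
      (G := fun h => ENNReal.ofReal q * ∑ A ∈ nullSets m, ENNReal.ofReal (Real.exp
        (∑ k, potentialWeight m A k * observedSum (llr g f) h k))) ?_
    · refine hstep.trans ?_
      rw [lintegral_const_mul' _ _ ENNReal.ofReal_ne_top]
      refine (mul_le_mul_right ih _).trans (le_of_eq ?_)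
      rw [← ENNReal.ofReal_mul hq0]
      congr 1; ring
    · intro h u
      rw [lintegral_finsetSum]
      swap
      · intro A _
        exact (hterm (n + 1) A).comp ((measurable_snoc n).comp
          (measurable_const.prodMk (measurable_const.prodMk measurable_id)))
      simp only [lintegral_exp_observedSum_snoc f g m hX]
      set a := Γ.select n (h, u) with ha
      have hprod1 : ∀ A ∈ nullSets m, ∏ i, F A (a.1 i) ≤ 1 := fun A hA =>
        Finset.prod_le_one' fun i _ => hF1 A hA _
      refine sum_le_mul_sum_of_dominated (nullSets m) _ _
        (fun A => ∃ i, a.1 i = m ∨ a.1 i ∈ A) hqδ hρq ?_ ?_ ?_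
      · intro A hA
        exact mul_le_of_le_one_right' (hprod1 A hA)
      · rintro A hA ⟨i, hi⟩
        rw [mul_comm]
        gcongr
        change ∏ i, F A (a.1 i) ≤ ρ
        rw [← Finset.mul_prod_erase _ _ (Finset.mem_univ i)]
        exact (mul_le_of_le_one_right' (Finset.prod_le_one' fun i _ => hF1 A hA _)).trans
          (hFρ A hA _ hi)
      · intro A hA
        obtain ⟨A', hA', hsel, hle⟩ := exists_dominating_nullSet hK hKM r m h hA
        refine ⟨A', hA', hsel, ?_⟩
        rw [sum_potentialWeight_mul hA, sum_potentialWeight_mul hA']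
        refine ENNReal.ofReal_le_ofReal (Real.exp_le_exp.2 ?_)
        exact div_le_div_of_nonneg_right hle (Nat.cast_nonneg _)

/-- Under the DGF policy the target leads by any given margin, up to an event of geometrically
small probability. -/
lemma exists_measure_margin_le (hfg : f ≪ g) (hgf : g ≪ f) (hne : f ≠ g) (hM : 2 ≤ M)
    (hK : 1 ≤ K) (hKM : K ≤ M) (r : Ranking f g M K) (m : Fin M) :
    ∃ C q : ℝ, 0 < C ∧ 0 ≤ q ∧ q < 1 ∧ ∀ (c : ℝ) (n : ℕ) (x : ℝ),
      law f g m {ω | ∃ k ≠ m, sumLLR f g ((dgf hM hKM r c).history ω n) m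
          - sumLLR f g ((dgf hM hKM r c).history ω n) k ≤ x}
        ≤ ENNReal.ofReal (C * q ^ n * Real.exp (x / M)) := by
  obtain ⟨C, q, hC, hq0, hq1, hE⟩ := exists_lintegral_potential_le hfg hgf hne hM hK hKM r m
  have hX : Measurable (llr g f) := measurable_llr g f
  refine ⟨C, q, hC, hq0, hq1, fun c n x => ?_⟩
  set Γ := dgf hM hKM r c
  have hmeas : Measurable fun ω => ∑ A ∈ nullSets m, ENNReal.ofReal (Real.exp
      (∑ k, potentialWeight m A k * observedSum (llr g f) (Γ.history ω n) k)) :=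
    Finset.measurable_sum _ fun A _ => (Finset.measurable_sum _ fun k _ =>
      ((measurable_observedSum hX k).comp (Γ.measurable_history n)).const_mul _).exp.ennreal_ofReal
  have hsub : {ω | ∃ k ≠ m, sumLLR f g (Γ.history ω n) m - sumLLR f g (Γ.history ω n) k ≤ x} ⊆
      {ω | ENNReal.ofReal (Real.exp (-(x / M))) ≤ ∑ A ∈ nullSets m, ENNReal.ofReal (Real.exp
        (∑ k, potentialWeight m A k * observedSum (llr g f) (Γ.history ω n) k))} := by
    rintro ω ⟨k, hk, hx⟩
    have hkA : {k} ∈ nullSets m :=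
      Finset.mem_filter.2 ⟨Finset.mem_univ _, by simp, by simp [Ne.symm hk]⟩
    refine le_trans ?_ (Finset.single_le_sum (f := fun A => ENNReal.ofReal (Real.exp
        (∑ k, potentialWeight m A k * observedSum (llr g f) (Γ.history ω n) k)))
      (fun _ _ => zero_le) hkA)
    refine ENNReal.ofReal_le_ofReal (Real.exp_le_exp.2 ?_)
    rw [sum_potentialWeight_mul hkA, Finset.sum_singleton, ← neg_div]
    refine div_le_div_of_nonneg_right ?_ (Nat.cast_nonneg _)
    simp only [sumLLR_eq_observedSum] at hx
    linarith
  refine (measure_mono hsub).trans ((meas_ge_le_lintegral_div hmeas.aemeasurable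
    (by simp [Real.exp_pos]) ENNReal.ofReal_ne_top).trans ?_)
  refine (ENNReal.div_le_div_right (hE c n) _).trans (le_of_eq ?_)
  rw [← ENNReal.ofReal_div_of_pos (Real.exp_pos _), Real.exp_neg, div_inv_eq_mul]

end Potential

/-! ### Numbers of probes -/

section Probes

variable {𝓨 : Type*} {M K : ℕ}

lemma probes_snoc {n : ℕ} (h : History 𝓨 M K n) (x : Record 𝓨 M K) (k : Fin M) :
    probes (Fin.snoc (α := fun _ => Record 𝓨 M K) h x : History 𝓨 M K (n + 1)) k
      = probes h k + ∑ i, if x.1.1 i = k then 1 else 0 :=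
  observedSum_snoc _ h x k

lemma sum_selected_of_mem (a : Selection M K) {k : Fin M} (hk : ∃ i, a.1 i = k) :
    ∑ i, (if a.1 i = k then (1 : ℝ) else 0) = 1 := by
  obtain ⟨i, hi⟩ := hk
  rw [Finset.sum_eq_single i]
  · simp [hi]
  · intro i' _ hne
    have : a.1 i' ≠ k := fun h' => hne (a.2 (h'.trans hi.symm))
    simp [this]
  · simp

lemma sum_selected_of_notMem (a : Selection M K) {k : Fin M} (hk : ¬∃ i, a.1 i = k) :
    ∑ i, (if a.1 i = k then (1 : ℝ) else 0) = 0 := by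
  push Not at hk
  simp [hk]

lemma sum_selected_le_one (a : Selection M K) (k : Fin M) :
    ∑ i, (if a.1 i = k then (1 : ℝ) else 0) ≤ 1 := by
  by_cases hk : ∃ i, a.1 i = k
  · exact (sum_selected_of_mem a hk).le
  · rw [sum_selected_of_notMem a hk]; exact zero_le_one

lemma probes_nonneg {n : ℕ} (h : History 𝓨 M K n) (k : Fin M) : 0 ≤ probes h k :=
  show (0 : ℝ) ≤ ∑ t : Fin n, ∑ i : Fin K, if (h t).1.1 i = k then (1 : ℝ) else 0 from
    Finset.sum_nonneg fun _ _ => Finset.sum_nonneg fun _ _ => by split_ifs <;> norm_num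

lemma probes_le {n : ℕ} (h : History 𝓨 M K n) (k : Fin M) : probes h k ≤ n := by
  calc probes h k ≤ ∑ _t : Fin n, (1 : ℝ) :=
        show ∑ t : Fin n, ∑ i : Fin K, (if (h t).1.1 i = k then (1 : ℝ) else 0) ≤ _ from
          Finset.sum_le_sum fun t _ => sum_selected_le_one (h t).1 k
    _ = n := by simp

lemma sum_probes {n : ℕ} (h : History 𝓨 M K n) : ∑ k, probes h k = K * n := by
  unfold probes observedSum
  rw [Finset.sum_comm]
  have : ∀ t : Fin n, ∑ k, ∑ i, (if (h t).1.1 i = k then (1 : ℝ) else 0) = K := by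
    intro t
    rw [Finset.sum_comm]
    simp
  simp only [this, Finset.sum_const, Finset.card_univ, Fintype.card_fin, nsmul_eq_mul, mul_comm]

lemma sum_probes_erase {n : ℕ} (h : History 𝓨 M K n) (m : Fin M) :
    ∑ k ∈ Finset.univ.erase m, probes h k = K * n - probes h m := by
  rw [← sum_probes h, ← Finset.add_sum_erase _ _ (Finset.mem_univ m)]
  ring

end Probes

/-! ### Trajectories of the DGF policy -/

section Trajectory

variable {𝓨 : Type*} [MeasurableSpace 𝓨] {f g : Measure 𝓨} {M K : ℕ}

/-- While the target leads, the null cells that the DGF policy selects are those with the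
highest sums among the null cells. -/
lemma sumLLR_le_of_selected (hM : 2 ≤ M) (hKM : K ≤ M) (r : Ranking f g M K) {m a b : Fin M}
    (hb : b ≠ m) {n : ℕ} (h : History 𝓨 M K n)
    (htop : r.cell n h ⟨0, by omega⟩ = m)
    (hsa : ∃ i, r.cell n h (dgfPosition f g hKM i) = a)
    (hsb : ¬∃ i, r.cell n h (dgfPosition f g hKM i) = b) :
    sumLLR f g h b ≤ sumLLR f g h a := by
  obtain ⟨i, hi⟩ := hsa
  obtain ⟨j, hj⟩ := r.exists_cell_eq h b
  have hj0 : (j : ℕ) ≠ 0 := by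
    intro h0
    have : j = ⟨0, by omega⟩ := Fin.ext h0
    rw [this, htop] at hj
    exact hb hj.symm
  have hij : dgfPosition f g hKM i ≤ j := by
    by_contra hlt
    rw [not_le, Fin.lt_def] at hlt
    by_cases hc : kl g f < kl f g / ((M : ℝ) - 1) ∧ K < M
    · have hp : ∀ i : Fin K, (dgfPosition f g hKM i : ℕ) = i + 1 := fun i => by
        simp [dgfPosition, hc]
      rw [hp] at hlt
      refine hsb ⟨⟨j - 1, by omega⟩, ?_⟩
      rw [← hj]; congr 1
      ext; rw [hp]; simp; omega
    · have hp : ∀ i : Fin K, (dgfPosition f g hKM i : ℕ) = i := fun i => by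
        simp [dgfPosition, hc]
      rw [hp] at hlt
      refine hsb ⟨⟨j, by omega⟩, ?_⟩
      rw [← hj]; congr 1
      ext; rw [hp]
  have := r.antitone n h hij
  simpa only [hi, hj] using this

/-- If the target leads from time `T` on, then any two null cells are probed about equally
often. Indeed a null cell is only probed in preference to another one when its sum is at least as
high, that is, when it has been probed about as often or less. -/
lemma kl_mul_probes_sub_le (hM : 2 ≤ M) (hKM : K ≤ M) (r : Ranking f g M K) (c : ℝ) {m : Fin M}
    (ω : SampleSpace 𝓨 M) {n T : ℕ} {η : ℝ}
    (hη : ∀ t ≤ n, ∀ k, |sumLLR f g ((dgf hM hKM r c).history ω t) k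
      - drift f g m k * probes ((dgf hM hKM r c).history ω t) k| ≤ η)
    (htop : ∀ t, T ≤ t → t < n →
      r.cell t ((dgf hM hKM r c).history ω t) ⟨0, by omega⟩ = m)
    {a b : Fin M} (ha : a ≠ m) (hb : b ≠ m) {t : ℕ} (ht : t ≤ n) :
    kl f g * (probes ((dgf hM hKM r c).history ω t) a
      - probes ((dgf hM hKM r c).history ω t) b) ≤ 2 * η + kl f g * (1 + T) := by
  have hDf : 0 ≤ kl f g := ENNReal.toReal_nonneg
  have hη0 : 0 ≤ η := (abs_nonneg _).trans (hη 0 (Nat.zero_le n) m)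
  induction t with
  | zero =>
    simp only [probes, observedSum_zero, sub_self, mul_zero]
    positivity
  | succ t ih =>
    have ih := ih (by omega)
    by_cases htT : t + 1 ≤ T
    · have h1 := probes_le ((dgf hM hKM r c).history ω (t + 1)) a
      have h2 := probes_nonneg ((dgf hM hKM r c).history ω (t + 1)) b
      have h3 : ((t + 1 : ℕ) : ℝ) ≤ T := by exact_mod_cast htT
      have := mul_le_mul_of_nonneg_left (show probes ((dgf hM hKM r c).history ω (t + 1)) a
        - probes ((dgf hM hKM r c).history ω (t + 1)) b ≤ 1 + T by linarith) hDf
      linarith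
    · rw [Strategy.history_succ, probes_snoc, probes_snoc]
      set h := (dgf hM hKM r c).history ω t with hh
      set s := (dgf hM hKM r c).select t (h, ω.1 t) with hs
      by_cases hsa : ∃ i, s.1 i = a
      · by_cases hsb : ∃ i, s.1 i = b
        · rw [sum_selected_of_mem s hsa, sum_selected_of_mem s hsb]
          linarith
        · rw [sum_selected_of_mem s hsa, sum_selected_of_notMem s hsb]
          have hle : sumLLR f g h b ≤ sumLLR f g h a :=
            sumLLR_le_of_selected hM hKM r hb h (htop t (by omega) (by omega)) hsa hsb
          have h1 := abs_le.1 (hη t (by omega) a)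
          have h2 := abs_le.1 (hη t (by omega) b)
          simp only [drift, ha, hb, if_false, ← hh] at h1 h2
          have hT : 0 ≤ kl f g * T := by positivity
          linarith [h1.2, h2.1]
      · rw [sum_selected_of_notMem s hsa]
        have h1 : 0 ≤ ∑ i, (if s.1 i = b then (1 : ℝ) else 0) :=
          Finset.sum_nonneg fun _ _ => by split_ifs <;> norm_num
        have := mul_nonneg hDf h1
        linarith

lemma le_probes_target (hM : 2 ≤ M) (hK : 1 ≤ K) (hKM : K ≤ M) (r : Ranking f g M K) (c : ℝ)
    {m : Fin M} (ω : SampleSpace 𝓨 M) {n T : ℕ}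
    (htop : ∀ t, T ≤ t → t < n →
      r.cell t ((dgf hM hKM r c).history ω t) ⟨0, by omega⟩ = m)
    (hc : ¬(kl g f < kl f g / ((M : ℝ) - 1) ∧ K < M)) {t : ℕ} (ht : t ≤ n) :
    (t : ℝ) - T ≤ probes ((dgf hM hKM r c).history ω t) m := by
  induction t with
  | zero =>
    have := probes_nonneg ((dgf hM hKM r c).history ω 0) m
    have : (0 : ℝ) ≤ T := Nat.cast_nonneg T
    push_cast; linarith
  | succ t ih =>
    have ih := ih (by omega)
    by_cases htT : t + 1 ≤ T
    · have h3 : ((t + 1 : ℕ) : ℝ) ≤ T := by exact_mod_cast htT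
      have := probes_nonneg ((dgf hM hKM r c).history ω (t + 1)) m
      linarith
    · rw [Strategy.history_succ, probes_snoc, sum_selected_of_mem]
      · push_cast; linarith
      · refine ⟨⟨0, hK⟩, ?_⟩
        have hp : dgfPosition f g hKM (⟨0, hK⟩ : Fin K) = ⟨0, by omega⟩ := by
          simp [dgfPosition, hc]
        change r.cell t _ (dgfPosition f g hKM (⟨0, hK⟩ : Fin K)) = m
        rw [hp]
        exact htop t (by omega) (by omega)

lemma probes_target_le (hM : 2 ≤ M) (hKM : K ≤ M) (r : Ranking f g M K) (c : ℝ)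
    {m : Fin M} (ω : SampleSpace 𝓨 M) {n T : ℕ}
    (htop : ∀ t, T ≤ t → t < n →
      r.cell t ((dgf hM hKM r c).history ω t) ⟨0, by omega⟩ = m)
    (hc : kl g f < kl f g / ((M : ℝ) - 1) ∧ K < M) {t : ℕ} (ht : t ≤ n) :
    probes ((dgf hM hKM r c).history ω t) m ≤ T := by
  induction t with
  | zero => simp [probes, observedSum_zero]
  | succ t ih =>
    have ih := ih (by omega)
    by_cases htT : t + 1 ≤ T
    · have h3 : ((t + 1 : ℕ) : ℝ) ≤ T := by exact_mod_cast htT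
      exact (probes_le _ m).trans h3
    · rw [Strategy.history_succ, probes_snoc, sum_selected_of_notMem, add_zero]
      · exact ih
      · rintro ⟨i, hi⟩
        change r.cell t _ (dgfPosition f g hKM i) = m at hi
        rw [← htop t (by omega) (by omega)] at hi
        have h1 := congrArg Fin.val (r.injective _ _ hi)
        simp [dgfPosition, hc] at h1

/-- Once the target leads, the DGF policy separates it from every other cell at the
rate `rate f g M K`, up to the fluctuations `η` of the sums. -/
lemma rate_mul_sub_le_margin (hM : 2 ≤ M) (hK : 1 ≤ K) (hKM : K ≤ M) (r : Ranking f g M K)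
    (c : ℝ) {m : Fin M} (ω : SampleSpace 𝓨 M) {n T : ℕ} {η : ℝ}
    (hη : ∀ t ≤ n, ∀ k, |sumLLR f g ((dgf hM hKM r c).history ω t) k
      - drift f g m k * probes ((dgf hM hKM r c).history ω t) k| ≤ η)
    (htop : ∀ t, T ≤ t → t < n →
      r.cell t ((dgf hM hKM r c).history ω t) ⟨0, by omega⟩ = m) {k : Fin M} (hk : k ≠ m) :
    rate f g M K * n - 4 * η - (kl g f + 2 * kl f g) * (1 + T)
      ≤ sumLLR f g ((dgf hM hKM r c).history ω n) m
        - sumLLR f g ((dgf hM hKM r c).history ω n) k := by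
  have hDf : 0 ≤ kl f g := ENNReal.toReal_nonneg
  have hDg : 0 ≤ kl g f := ENNReal.toReal_nonneg
  have hM1 : (0 : ℝ) < (M : ℝ) - 1 := by
    have : (2 : ℝ) ≤ M := by exact_mod_cast hM
    linarith
  have hM1' : (1 : ℝ) ≤ (M : ℝ) - 1 := by
    have : (2 : ℝ) ≤ M := by exact_mod_cast hM
    linarith
  set h := (dgf hM hKM r c).history ω n with hh
  set N := probes h m with hN
  have hNn : N ≤ n := probes_le h m
  have hN0 : 0 ≤ N := probes_nonneg h m
  have hT0 : (0 : ℝ) ≤ T := Nat.cast_nonneg T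
  have hbal : kl f g * (K * n - N) - ((M : ℝ) - 1) * (kl f g * probes h k)
      ≤ ((M : ℝ) - 1) * (2 * η + kl f g * (1 + T)) := by
    have hsum : ∑ a ∈ Finset.univ.erase m, kl f g * (probes h a - probes h k)
        ≤ ∑ a ∈ Finset.univ.erase m, (2 * η + kl f g * (1 + T)) :=
      Finset.sum_le_sum fun a ha =>
        kl_mul_probes_sub_le hM hKM r c ω hη htop (Finset.ne_of_mem_erase ha) hk le_rfl
    have hcard : ((Finset.univ.erase m).card : ℝ) = (M : ℝ) - 1 := by
      rw [Finset.card_erase_of_mem (Finset.mem_univ m), Finset.card_univ, Fintype.card_fin,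
        Nat.cast_sub (by omega)]
      simp
    rw [← Finset.mul_sum, Finset.sum_sub_distrib, sum_probes_erase, Finset.sum_const,
      Finset.sum_const, nsmul_eq_mul, nsmul_eq_mul, hcard] at hsum
    linarith
  have hk' := abs_le.1 (hη n le_rfl k)
  have hm' := abs_le.1 (hη n le_rfl m)
  simp only [drift, hk, if_false, if_true, ← hh, ← hN] at hk' hm'
  have hlow : kl g f * N + kl f g * (K * n - N) / ((M : ℝ) - 1) - 4 * η - kl f g * (1 + T)
      ≤ sumLLR f g h m - sumLLR f g h k := by
    have h1 : kl f g * (K * n - N) / ((M : ℝ) - 1)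
        ≤ kl f g * probes h k + (2 * η + kl f g * (1 + T)) := by
      rw [div_le_iff₀ hM1]; linarith
    linarith [hk'.2, hm'.1]
  refine le_trans ?_ hlow
  have hDgT : 0 ≤ kl g f * T := mul_nonneg hDg hT0
  by_cases hc : kl g f < kl f g / ((M : ℝ) - 1) ∧ K < M
  · have hNT : N ≤ T := probes_target_le hM hKM r c ω htop hc le_rfl
    have hrate : rate f g M K = K * kl f g / ((M : ℝ) - 1) := by
      rw [rate, if_neg hc.2.ne, max_eq_left]
      have e : (K : ℝ) * kl f g / ((M : ℝ) - 1)
          = kl f g / ((M : ℝ) - 1) + ((K : ℝ) - 1) * kl f g / ((M : ℝ) - 1) := by ring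
      rw [e]; linarith [hc.1]
    rw [hrate]
    have e : kl g f * N + kl f g * (K * n - N) / ((M : ℝ) - 1)
        = K * kl f g / ((M : ℝ) - 1) * n - (kl f g / ((M : ℝ) - 1) - kl g f) * N := by ring
    rw [e]
    have h1 : kl f g / ((M : ℝ) - 1) ≤ kl f g := div_le_self hDf hM1'
    have h2 : (kl f g / ((M : ℝ) - 1) - kl g f) * N ≤ (kl f g / ((M : ℝ) - 1) - kl g f) * T :=
      mul_le_mul_of_nonneg_left hNT (by linarith [hc.1])
    have h3 : (kl f g / ((M : ℝ) - 1) - kl g f) * T ≤ kl f g * T :=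
      mul_le_mul_of_nonneg_right (by linarith) hT0
    linarith
  · have hNT : (n : ℝ) - T ≤ N := le_probes_target hM hK hKM r c ω htop hc le_rfl
    have hDfT : 0 ≤ kl f g * T := mul_nonneg hDf hT0
    rcases hKM.eq_or_lt with hKM' | hKM'
    · have hrate : rate f g M K = kl g f + kl f g := if_pos hKM'
      have h1 : kl f g * n ≤ kl f g * (K * n - N) / ((M : ℝ) - 1) := by
        rw [le_div_iff₀ hM1, hKM', mul_assoc]
        exact mul_le_mul_of_nonneg_left (by linarith) hDf
      have h2 := mul_le_mul_of_nonneg_left hNT hDg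
      rw [hrate]
      linarith
    · have hα : kl f g / ((M : ℝ) - 1) ≤ kl g f := by
        by_contra hlt
        exact hc ⟨not_le.1 hlt, hKM'⟩
      have hrate : rate f g M K = kl g f + ((K : ℝ) - 1) * kl f g / ((M : ℝ) - 1) := by
        rw [rate, if_neg hKM'.ne, max_eq_right]
        have e : (K : ℝ) * kl f g / ((M : ℝ) - 1)
            = kl f g / ((M : ℝ) - 1) + ((K : ℝ) - 1) * kl f g / ((M : ℝ) - 1) := by ring
        rw [e]; linarith
      have e : kl g f * N + kl f g * (K * n - N) / ((M : ℝ) - 1)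
          = (kl g f - kl f g / ((M : ℝ) - 1)) * N + K * kl f g / ((M : ℝ) - 1) * n := by ring
      have h2 := mul_le_mul_of_nonneg_left hNT (sub_nonneg.2 hα)
      have h3 : 0 ≤ kl f g / ((M : ℝ) - 1) * T := by positivity
      rw [hrate, e]
      have e2 : ((K : ℝ) - 1) * kl f g / ((M : ℝ) - 1)
          = K * kl f g / ((M : ℝ) - 1) - kl f g / ((M : ℝ) - 1) := by ring
      rw [e2]
      linarith

/-- As long as the DGF policy has not stopped, the target leads some other cell by less than
`-log c`. -/
lemma exists_margin_lt_of_notMem_stopSet (hM : 2 ≤ M) (hKM : K ≤ M) (r : Ranking f g M K)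
    (m : Fin M) {c : ℝ} (hL : 0 < -Real.log c) {n : ℕ} {h : History 𝓨 M K n}
    (hh : h ∉ (dgf hM hKM r c).stopSet n) :
    ∃ k ≠ m, sumLLR f g h m - sumLLR f g h k < -Real.log c := by
  by_contra hcon
  push Not at hcon
  refine hh ?_
  have htop : r.cell n h ⟨0, by omega⟩ = m := by
    by_contra hne
    have h1 := hcon _ hne
    obtain ⟨i, hi⟩ := r.exists_cell_eq h m
    have h2 := r.antitone n h (show (⟨0, by omega⟩ : Fin M) ≤ i from Nat.zero_le _)
    simp only [hi] at h2
    linarith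
  have hsec : r.cell n h ⟨1, by omega⟩ ≠ m := by
    rw [← htop]
    intro h1
    simpa using r.injective n h h1
  change -Real.log c ≤ sumLLR f g h (r.cell n h ⟨0, by omega⟩)
    - sumLLR f g h (r.cell n h ⟨1, by omega⟩)
  rw [htop]
  exact hcon _ hsec

/-- No strategy separates the target from all other cells at a higher rate than
`rate f g M K`: the smallest of the differences is at most their average. -/
lemma exists_margin_le_rate_mul (hM : 2 ≤ M) (hKM : K ≤ M) {m : Fin M} {n : ℕ}
    (h : History 𝓨 M K n) {η : ℝ}
    (hη : ∀ k, |sumLLR f g h k - drift f g m k * probes h k| ≤ η) :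
    ∃ k ≠ m, sumLLR f g h m - sumLLR f g h k ≤ rate f g M K * n + 2 * η := by
  have hDf : 0 ≤ kl f g := ENNReal.toReal_nonneg
  have hDg : 0 ≤ kl g f := ENNReal.toReal_nonneg
  have hM1 : (0 : ℝ) < (M : ℝ) - 1 := by
    have : (2 : ℝ) ≤ M := by exact_mod_cast hM
    linarith
  set N := probes h m with hN
  have hNn : N ≤ n := probes_le h m
  have hN0 : 0 ≤ N := probes_nonneg h m
  have hcard : ((Finset.univ.erase m).card : ℝ) = (M : ℝ) - 1 := by
    rw [Finset.card_erase_of_mem (Finset.mem_univ m), Finset.card_univ, Fintype.card_fin,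
      Nat.cast_sub (by omega)]
    simp
  have hgame : kl g f * N + kl f g * (K * n - N) / ((M : ℝ) - 1) ≤ rate f g M K * n := by
    rcases hKM.eq_or_lt with hKM' | hKM'
    · have hNn' : N = n := by
        have h1 : ∑ k, probes h k = ∑ _k : Fin M, (n : ℝ) := by
          rw [sum_probes]; simp [hKM']
        have h2 := (Finset.sum_eq_sum_iff_of_le fun k _ => probes_le h k).1 h1
        exact h2 m (Finset.mem_univ m)
      rw [rate, if_pos hKM', hNn', hKM']
      have e : kl f g * ((M : ℝ) * n - n) / ((M : ℝ) - 1) = kl f g * n := by field_simp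
      rw [e, add_mul]
    · have hr1 : (K : ℝ) * kl f g / ((M : ℝ) - 1) ≤ rate f g M K := by
        rw [rate, if_neg hKM'.ne]; exact le_max_left _ _
      have hr2 : kl g f + ((K : ℝ) - 1) * kl f g / ((M : ℝ) - 1) ≤ rate f g M K := by
        rw [rate, if_neg hKM'.ne]; exact le_max_right _ _
      have e : kl g f * N + kl f g * (K * n - N) / ((M : ℝ) - 1)
          = (kl g f + ((K : ℝ) - 1) * kl f g / ((M : ℝ) - 1)) * N
            + K * kl f g / ((M : ℝ) - 1) * (n - N) := by ring
      rw [e]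
      have h1 := mul_le_mul_of_nonneg_right hr2 hN0
      have h2 := mul_le_mul_of_nonneg_right hr1 (sub_nonneg.2 hNn)
      linarith
  have hne : (Finset.univ.erase m).Nonempty := by
    rw [← Finset.card_pos]
    have : (0 : ℝ) < (Finset.univ.erase m).card := by rw [hcard]; exact hM1
    exact_mod_cast this
  have hsum : ∑ k ∈ Finset.univ.erase m, (sumLLR f g h m - sumLLR f g h k)
      ≤ ∑ k ∈ Finset.univ.erase m, (rate f g M K * n + 2 * η) := by
    have h1 : ∀ k ∈ Finset.univ.erase m, sumLLR f g h m - sumLLR f g h k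
        ≤ kl g f * N + 2 * η + kl f g * probes h k := by
      intro k hk
      have hk' := abs_le.1 (hη k)
      have hm' := abs_le.1 (hη m)
      simp only [drift, Finset.ne_of_mem_erase hk, if_false, if_true, ← hN] at hk' hm'
      linarith [hk'.1, hm'.2]
    refine (Finset.sum_le_sum h1).trans ?_
    rw [Finset.sum_add_distrib, ← Finset.mul_sum, sum_probes_erase, Finset.sum_const,
      Finset.sum_const, nsmul_eq_mul, nsmul_eq_mul, hcard, ← hN]
    have h3 := mul_le_mul_of_nonneg_left hgame hM1.le
    have e : ((M : ℝ) - 1) * (kl g f * N + kl f g * (K * n - N) / ((M : ℝ) - 1))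
        = ((M : ℝ) - 1) * (kl g f * N) + kl f g * (K * n - N) := by
      field_simp
    rw [e] at h3
    linarith
  obtain ⟨k, hk, hle⟩ := Finset.exists_le_of_sum_le hne hsum
  exact ⟨k, Finset.ne_of_mem_erase hk, hle⟩

end Trajectory

/-! ### The risk of the DGF policy -/

section Upper

variable {𝓨 : Type*} [MeasurableSpace 𝓨] {f g : Measure 𝓨} [IsProbabilityMeasure f]
  [IsProbabilityMeasure g] {M K : ℕ}

lemma kl_pos {p q : Measure 𝓨} [IsProbabilityMeasure p] [IsProbabilityMeasure q] (hne : p ≠ q)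
    (hD : klDiv p q ≠ ∞) : 0 < kl p q :=
  ENNReal.toReal_pos (fun h => hne (klDiv_eq_zero_iff.1 h)) hD

lemma rate_pos (hne : f ≠ g) (hDgf : klDiv g f ≠ ∞) (hDfg : klDiv f g ≠ ∞) (hM : 2 ≤ M)
    (hK : 1 ≤ K) : 0 < rate f g M K := by
  have h1 := kl_pos hne.symm hDgf
  have h2 := kl_pos hne hDfg
  have hM1 : (0 : ℝ) < (M : ℝ) - 1 := by
    have : (2 : ℝ) ≤ M := by exact_mod_cast hM
    linarith
  have hK1 : (1 : ℝ) ≤ K := by exact_mod_cast hK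
  unfold rate
  split_ifs
  · positivity
  · refine lt_max_of_lt_left ?_
    positivity

/-- With high probability the target leads by almost `rate f g M K * n` at time `n`. -/
lemma exists_measure_margin_lt_rate_mul (hne : f ≠ g) (hDgf : klDiv g f ≠ ∞)
    (hDfg : klDiv f g ≠ ∞) (hM : 2 ≤ M) (hK : 1 ≤ K) (hKM : K ≤ M) (r : Ranking f g M K)
    (m : Fin M) {ι p : ℝ} (hι : 0 < ι) (hp : 0 < p) :
    ∃ n₀ : ℕ, ∀ n ≥ n₀, ∀ c : ℝ,
      law f g m {ω | ∃ k ≠ m, sumLLR f g ((dgf hM hKM r c).history ω n) m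
          - sumLLR f g ((dgf hM hKM r c).history ω n) k < (rate f g M K - ι) * n}
        ≤ ENNReal.ofReal p := by
  have hgf := (klDiv_ne_top_iff.1 hDgf).1
  have hfg := (klDiv_ne_top_iff.1 hDfg).1
  obtain ⟨C, q, hC, hq0, hq1, hlead⟩ := exists_measure_margin_le hfg hgf hne hM hK hKM r m
  obtain ⟨n₁, hn₁⟩ := exists_forall_measure_sumLLR_sub_le (K := K) hDgf hDfg m
    (show 0 < ι / 8 by positivity) (half_pos hp)
  obtain ⟨T, hT⟩ : ∃ T : ℕ, C * q ^ T * (1 - q)⁻¹ ≤ p / 2 := by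
    have h1 : Filter.Tendsto (fun T : ℕ => C * q ^ T * (1 - q)⁻¹) Filter.atTop (𝓝 0) := by
      simpa using ((tendsto_pow_atTop_nhds_zero_of_lt_one hq0 hq1).const_mul C).mul_const
        (1 - q)⁻¹
    exact (h1.eventually_le_const (half_pos hp)).exists
  obtain ⟨n₂, hn₂⟩ := exists_nat_ge ((kl g f + 2 * kl f g) * (1 + T) / (ι / 2))
  refine ⟨max n₁ n₂, fun n hn c => ?_⟩
  set Γ := dgf hM hKM r c with hΓ
  have hcover : {ω | ∃ k ≠ m, sumLLR f g (Γ.history ω n) m - sumLLR f g (Γ.history ω n) k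
        < (rate f g M K - ι) * n} ⊆
      (⋃ i : ℕ, {ω | ∃ k ≠ m, sumLLR f g (Γ.history ω (T + i)) m
        - sumLLR f g (Γ.history ω (T + i)) k ≤ 0}) ∪
      {ω | ∃ t ≤ n, ∃ k, ι / 8 * n ≤ |sumLLR f g (Γ.history ω t) k
        - drift f g m k * probes (Γ.history ω t) k|} := by
    rintro ω ⟨k, hk, hlt⟩
    by_contra hcon
    simp only [Set.mem_union, Set.mem_iUnion, not_or, not_exists, Set.mem_ofPred_eq, not_and,
      not_le] at hcon
    have htop : ∀ t, T ≤ t → t < n → r.cell t (Γ.history ω t) ⟨0, by omega⟩ = m := by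
      intro t hTt _
      by_contra hne'
      have h1 := hcon.1 (t - T) _ hne'
      rw [Nat.add_sub_cancel' hTt] at h1
      obtain ⟨i, hi⟩ := r.exists_cell_eq (Γ.history ω t) m
      have h2 := r.antitone t (Γ.history ω t)
        (show (⟨0, by omega⟩ : Fin M) ≤ i from Nat.zero_le _)
      simp only [hi] at h2
      linarith
    have hη : ∀ t ≤ n, ∀ k, |sumLLR f g (Γ.history ω t) k
        - drift f g m k * probes (Γ.history ω t) k| ≤ ι / 8 * n :=
      fun t ht k => (hcon.2 t ht k).le
    have h1 := rate_mul_sub_le_margin hM hK hKM r c ω hη htop hk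
    have h2 : (kl g f + 2 * kl f g) * (1 + T) ≤ ι / 2 * n := by
      rw [div_le_iff₀ (half_pos hι)] at hn₂
      have h3 : (n₂ : ℝ) ≤ n := by exact_mod_cast (le_max_right _ _).trans hn
      have h4 := mul_le_mul_of_nonneg_right h3 (half_pos hι).le
      linarith
    linarith
  refine (measure_mono hcover).trans ((measure_union_le _ _).trans ?_)
  rw [← add_halves p, ENNReal.ofReal_add (half_pos hp).le (half_pos hp).le]
  refine add_le_add ?_ (hn₁ n ((le_max_left _ _).trans hn) Γ)
  calc _ ≤ ∑' i : ℕ, ENNReal.ofReal (C * q ^ T * q ^ i) := by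
        refine (measure_iUnion_le _).trans (ENNReal.tsum_le_tsum fun i => ?_)
        refine (hlead c (T + i) 0).trans (le_of_eq ?_)
        rw [zero_div, Real.exp_zero, mul_one, pow_add, mul_assoc]
    _ = ENNReal.ofReal (C * q ^ T * (1 - q)⁻¹) := by
        rw [← ENNReal.ofReal_tsum_of_nonneg (fun i => by positivity)
          ((summable_geometric_of_lt_one hq0 hq1).mul_left _), tsum_mul_left,
          tsum_geometric_of_lt_one hq0 hq1]
    _ ≤ _ := ENNReal.ofReal_le_ofReal hT

/-- A series whose terms are at most `1`, from some point on at most `p`, and after `N` further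
terms dominated by a geometric sequence. -/
lemma tsum_le_of_three_bounds {u : ℕ → ℝ≥0∞} {n₁ N : ℕ} {p C q : ℝ} (hp : 0 ≤ p) (hC : 0 ≤ C)
    (hq0 : 0 ≤ q) (hq1 : q < 1) (h1 : ∀ s, u s ≤ 1) (h2 : ∀ s ≥ n₁, u s ≤ ENNReal.ofReal p)
    (h3 : ∀ i, u (i + N + n₁) ≤ ENNReal.ofReal (C * q ^ i)) :
    ∑' s, u s ≤ ENNReal.ofReal (n₁ + N * p + C * (1 - q)⁻¹) := by
  have hq' : 0 ≤ (1 - q)⁻¹ := inv_nonneg.2 (by linarith)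
  rw [← ENNReal.summable.sum_add_tsum_nat_add' (k := n₁),
    ← ENNReal.summable.sum_add_tsum_nat_add' (k := N), ← add_assoc,
    ENNReal.ofReal_add (by positivity) (by positivity),
    ENNReal.ofReal_add (by positivity) (by positivity)]
  refine add_le_add (add_le_add ?_ ?_) ?_
  · calc _ ≤ ∑ _s ∈ Finset.range n₁, (1 : ℝ≥0∞) := Finset.sum_le_sum fun s _ => h1 s
      _ = _ := by simp
  · calc _ ≤ ∑ _s ∈ Finset.range N, ENNReal.ofReal p :=
          Finset.sum_le_sum fun s _ => h2 _ (Nat.le_add_left _ _)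
      _ = _ := by
          rw [Finset.sum_const, Finset.card_range, nsmul_eq_mul,
            ENNReal.ofReal_mul (Nat.cast_nonneg _), ENNReal.ofReal_natCast]
  · calc _ ≤ ∑' i : ℕ, ENNReal.ofReal (C * q ^ i) := ENNReal.tsum_le_tsum fun i => h3 i
      _ = _ := by
          rw [← ENNReal.ofReal_tsum_of_nonneg (fun i => by positivity)
            ((summable_geometric_of_lt_one hq0 hq1).mul_left _), tsum_mul_left,
            tsum_geometric_of_lt_one hq0 hq1]

/-- The bound on the expected detection time of the DGF policy. It is stated for the series that
dominates this expectation, because the convergence of the series also shows that the policy stops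
almost surely. -/
lemma exists_tsum_measure_notMem_stopSet_le (hne : f ≠ g) (hDgf : klDiv g f ≠ ∞)
    (hDfg : klDiv f g ≠ ∞) (hM : 2 ≤ M) (hK : 1 ≤ K) (hKM : K ≤ M) (r : Ranking f g M K)
    (m : Fin M) {ε : ℝ} (hε : 0 < ε) :
    ∃ b : ℝ, ∀ c : ℝ, 0 < -Real.log c →
      ∑' n, law f g m {ω | (dgf hM hKM r c).history ω n ∉ (dgf hM hKM r c).stopSet n}
        ≤ ENNReal.ofReal ((1 + ε) * (-Real.log c / rate f g M K) + b) := by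
  have hgf := (klDiv_ne_top_iff.1 hDgf).1
  have hfg := (klDiv_ne_top_iff.1 hDfg).1
  have hI : 0 < rate f g M K := rate_pos hne hDgf hDfg hM hK
  have hMpos : (0 : ℝ) < M := by exact_mod_cast (show 0 < M by omega)
  obtain ⟨C, q₀, hC, hq₀, hq₀1, hlead⟩ := exists_measure_margin_le hfg hgf hne hM hK hKM r m
  set q := max q₀ (1 / 2) with hq
  have hqpos : 0 < q := lt_max_of_lt_right (by norm_num)
  have hq1 : q < 1 := max_lt hq₀1 (by norm_num)
  have hlogq : 0 < -Real.log q := neg_pos.2 (Real.log_neg hqpos hq1)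
  -- after `a * L` further steps the geometric bound takes over
  set a := 1 / (M * -Real.log q) with ha
  have hapos : 0 < a := by positivity
  set I := rate f g M K with hIdef
  -- the loss `ι` of rate makes `L / (I - ι)` equal to `(1 + ε / 2) * (L / I)`
  set ι := I - I / (1 + ε / 2) with hι
  have hιpos : 0 < ι := by
    rw [hι, sub_pos, div_lt_iff₀ (by positivity)]
    nlinarith
  -- `p` is chosen such that `a * L` steps of probability at most `p` cost `ε / 2 * (L / I)`
  set p := ε / 2 / I / a with hp
  have hppos : 0 < p := by positivity
  obtain ⟨n₀, hn₀⟩ :=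
    exists_measure_margin_lt_rate_mul hne hDgf hDfg hM hK hKM r m hιpos hppos
  refine ⟨n₀ + 1 + p + C * (1 - q)⁻¹, fun c hL => ?_⟩
  set L := -Real.log c with hLdef
  set Γ := dgf hM hKM r c with hΓ
  have hmono : ∀ n (x : ℝ), L ≤ x →
      law f g m {ω | Γ.history ω n ∉ Γ.stopSet n} ≤ law f g m {ω | ∃ k ≠ m,
        sumLLR f g (Γ.history ω n) m - sumLLR f g (Γ.history ω n) k < x} := by
    intro n x hx
    refine measure_mono fun ω hω => ?_
    obtain ⟨k, hk, hlt⟩ := exists_margin_lt_of_notMem_stopSet hM hKM r m hL hω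
    exact ⟨k, hk, hlt.trans_le hx⟩
  set n₁ := max n₀ ⌈(1 + ε / 2) * (L / I)⌉₊ with hn₁
  set N := ⌈a * L⌉₊ with hN
  refine (tsum_le_of_three_bounds (n₁ := n₁) (N := N) hppos.le hC.le hqpos.le hq1
    (fun s => prob_le_one) (fun s hs => ?_) fun i => ?_).trans (ENNReal.ofReal_le_ofReal ?_)
  · refine (hmono s ((I - ι) * s) ?_).trans
      (hn₀ s ((le_max_left _ _).trans hs) c)
    have h1 : (1 + ε / 2) * (L / I) ≤ s :=
      (Nat.le_ceil _).trans (by exact_mod_cast (le_max_right _ _).trans hs)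
    have h2 : I - ι = I / (1 + ε / 2) := by rw [hι]; ring
    rw [h2]
    calc L = I / (1 + ε / 2) * ((1 + ε / 2) * (L / I)) := by field_simp
      _ ≤ _ := mul_le_mul_of_nonneg_left h1 (by positivity)
  · refine (hmono _ L le_rfl).trans ((measure_mono ?_).trans
      ((hlead c (i + N + n₁) L).trans (ENNReal.ofReal_le_ofReal ?_)))
    · rintro ω ⟨k, hk, hlt⟩
      exact ⟨k, hk, hlt.le⟩
    · have h1 : q₀ ^ (i + N + n₁) ≤ q ^ i * q ^ N := by
        calc q₀ ^ (i + N + n₁) ≤ q ^ (i + N + n₁) := pow_le_pow_left₀ hq₀ (le_max_left _ _) _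
          _ ≤ q ^ (i + N) := pow_le_pow_of_le_one hqpos.le hq1.le (Nat.le_add_right _ _)
          _ = _ := pow_add _ _ _
      have h2 : q ^ N * Real.exp (L / M) ≤ 1 := by
        have e : q ^ N = Real.exp (N * Real.log q) := by
          rw [Real.exp_nat_mul, Real.exp_log hqpos]
        rw [e, ← Real.exp_add, Real.exp_le_one_iff]
        have h3 : a * L ≤ N := Nat.le_ceil _
        have h4 := mul_le_mul_of_nonneg_right h3 hlogq.le
        have h5 : a * L * -Real.log q = L / M := by
          rw [ha]
          have := (neg_pos.1 hlogq).ne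
          field_simp
        linarith
      calc C * q₀ ^ (i + N + n₁) * Real.exp (L / M)
          ≤ C * (q ^ i * q ^ N) * Real.exp (L / M) := by gcongr
        _ = C * q ^ i * (q ^ N * Real.exp (L / M)) := by ring
        _ ≤ C * q ^ i * 1 := by gcongr
        _ = C * q ^ i := mul_one _
  · have h1 : (n₁ : ℝ) ≤ n₀ + ((1 + ε / 2) * (L / I) + 1) := by
      have hc := (Nat.ceil_lt_add_one (show 0 ≤ (1 + ε / 2) * (L / I) by positivity)).le
      rw [hn₁, Nat.cast_max]
      have hx : (0 : ℝ) ≤ n₀ := Nat.cast_nonneg _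
      have hy : (0 : ℝ) ≤ (1 + ε / 2) * (L / I) := by positivity
      exact max_le (by linarith) (by linarith)
    have h2 : (N : ℝ) * p ≤ (a * L + 1) * p :=
      mul_le_mul_of_nonneg_right (Nat.ceil_lt_add_one (by positivity)).le hppos.le
    have h3 : (a * L + 1) * p = ε / 2 * (L / I) + p := by
      rw [hp]; field_simp
    linarith

/-- By the change of measure, the DGF policy errs with a probability of order `c`. -/
lemma errorProb_dgf_le (hDgf : klDiv g f ≠ ∞) (hDfg : klDiv f g ≠ ∞) (hM : 2 ≤ M)
    (hKM : K ≤ M) (r : Ranking f g M K) (m : Fin M) {c : ℝ} (hc0 : 0 < c)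
    (hsum : ∑' n, law f g m {ω | (dgf hM hKM r c).history ω n ∉ (dgf hM hKM r c).stopSet n}
      ≠ ∞) :
    (dgf hM hKM r c).errorProb f g m ≤ M * ENNReal.ofReal c := by
  have hgf := (klDiv_ne_top_iff.1 hDgf).1
  have hfg := (klDiv_ne_top_iff.1 hDfg).1
  set Γ := dgf hM hKM r c with hΓ
  have hnever : law f g m {ω | ∀ n, Γ.history ω n ∉ Γ.stopSet n} = 0 := by
    refine le_antisymm (ge_of_tendsto' (ENNReal.tendsto_atTop_zero_of_tsum_ne_top hsum)
      fun n => measure_mono fun ω hω => hω n) zero_le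
  have hwrong : ∀ l ≠ m, law f g m (Γ.declares l) ≤ ENNReal.ofReal c := by
    intro l hl
    have hsub : Γ.declares l ⊆ {ω | ∃ n : ℕ, Γ.stopTime ω = n ∧ Γ.decide n (Γ.history ω n) = l ∧
        sumLLR f g (Γ.history ω n) m - sumLLR f g (Γ.history ω n) l ≤ Real.log c} := by
      rintro ω ⟨n, hn, hd⟩
      refine ⟨n, hn, hd, ?_⟩
      have hmem := ((Γ.stopTime_eq_iff ω n).1 hn).1
      set h := Γ.history ω n
      change -Real.log c ≤ sumLLR f g h (r.cell n h ⟨0, by omega⟩)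
        - sumLLR f g h (r.cell n h ⟨1, by omega⟩) at hmem
      have hd' : r.cell n h ⟨0, by omega⟩ = l := hd
      obtain ⟨i, hi⟩ := r.exists_cell_eq h m
      have hi0 : (i : ℕ) ≠ 0 := by
        intro h0
        have : i = ⟨0, by omega⟩ := Fin.ext h0
        rw [this, hd'] at hi
        exact hl hi
      have h2 := r.antitone n h
        (show (⟨1, by omega⟩ : Fin M) ≤ i from Nat.one_le_iff_ne_zero.2 hi0)
      simp only [hi] at h2
      rw [hd'] at hmem
      linarith
    calc law f g m (Γ.declares l) ≤ _ := measure_mono hsub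
      _ ≤ ENNReal.ofReal (Real.exp (Real.log c)) * law f g l (Γ.declares l) :=
          Γ.measure_declares_sumLLR_le f g hfg hgf hl.symm l _
      _ ≤ ENNReal.ofReal c * 1 := by
          rw [Real.exp_log hc0]
          gcongr
          exact prob_le_one
      _ = _ := mul_one _
  have hcover : (Γ.declares m)ᶜ ⊆ {ω | ∀ n, Γ.history ω n ∉ Γ.stopSet n} ∪
      ⋃ l ∈ Finset.univ.erase m, Γ.declares l := by
    intro ω hω
    rcases eq_or_ne (Γ.stopTime ω) ⊤ with h | h
    · left
      intro n
      refine (Γ.lt_stopTime_iff ω n).1 ?_ n le_rfl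
      rw [h]; exact ENat.natCast_lt_top n
    · right
      obtain ⟨n, hn⟩ := ENat.ne_top_iff_exists.1 h
      refine Set.mem_biUnion (x := Γ.decide n (Γ.history ω n)) ?_ ⟨n, hn.symm, rfl⟩
      rw [Finset.mem_coe, Finset.mem_erase]
      exact ⟨fun hd => hω ⟨n, hn.symm, hd⟩, Finset.mem_univ _⟩
  calc Γ.errorProb f g m ≤ _ := measure_mono hcover
    _ ≤ 0 + ∑ l ∈ Finset.univ.erase m, law f g m (Γ.declares l) := by
        refine (measure_union_le _ _).trans ?_
        rw [hnever]
        gcongr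
        exact measure_biUnion_finset_le _ _
    _ ≤ ∑ l ∈ Finset.univ.erase m, ENNReal.ofReal c := by
        rw [zero_add]
        exact Finset.sum_le_sum fun l hl => hwrong l (Finset.ne_of_mem_erase hl)
    _ ≤ ∑ _l : Fin M, ENNReal.ofReal c :=
        Finset.sum_le_sum_of_subset (Finset.erase_subset _ _)
    _ = _ := by simp

lemma sum_ofReal_prior_mul {prior : Fin M → ℝ} (hprior : ∀ m, 0 < prior m)
    (hsum : ∑ m, prior m = 1) (x : ℝ≥0∞) : ∑ m, ENNReal.ofReal (prior m) * x = x := by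
  rw [← Finset.sum_mul, ← ENNReal.ofReal_sum_of_nonneg fun m _ => (hprior m).le, hsum,
    ENNReal.ofReal_one, one_mul]

/-- The risk of the DGF policy is at most `-(1 + ε) c log c / I*(M, K)` for small `c`. -/
lemma eventually_bayesRisk_dgf_le (hne : f ≠ g) (hDgf : klDiv g f ≠ ∞)
    (hDfg : klDiv f g ≠ ∞) (hM : 2 ≤ M) (hK : 1 ≤ K) (hKM : K ≤ M) (r : Ranking f g M K)
    {prior : Fin M → ℝ} (hprior : ∀ m, 0 < prior m) (hsum : ∑ m, prior m = 1) {ε : ℝ}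
    (hε : 0 < ε) :
    ∀ᶠ c in 𝓝[>] (0 : ℝ), (dgf hM hKM r c).bayesRisk f g prior c
      ≤ ENNReal.ofReal ((1 + ε) * (-c * Real.log c / rate f g M K)) := by
  have hI : 0 < rate f g M K := rate_pos hne hDgf hDfg hM hK
  choose b hb using fun m =>
    exists_tsum_measure_notMem_stopSet_le hne hDgf hDfg hM hK hKM r m (half_pos hε)
  set b' := ∑ m, |b m| with hb'
  have hbb : ∀ m, b m ≤ b' := fun m => (le_abs_self _).trans
    (Finset.single_le_sum (f := fun m => |b m|) (fun _ _ => abs_nonneg _) (Finset.mem_univ m))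
  have hlog : Filter.Tendsto (fun c : ℝ => -Real.log c) (𝓝[>] 0) Filter.atTop :=
    Filter.tendsto_neg_atBot_atTop.comp Real.tendsto_log_nhdsGT_zero
  filter_upwards [self_mem_nhdsWithin, hlog.eventually_gt_atTop 0,
    hlog.eventually_ge_atTop ((M + b') / (ε / 2 / rate f g M K))] with c hc0 hL hLbig
  have hc0 : 0 < c := hc0
  set L := -Real.log c with hLdef
  set I := rate f g M K with hIdef
  have hb0 : 0 ≤ b' := Finset.sum_nonneg fun _ _ => abs_nonneg _
  have hpos : 0 ≤ (1 + ε / 2) * (L / I) + b' := by positivity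
  have hbound : ∀ m, (dgf hM hKM r c).errorProb f g m
      + ENNReal.ofReal c * (dgf hM hKM r c).expectedTime f g m
      ≤ ENNReal.ofReal ((1 + ε) * (-c * Real.log c / I)) := by
    intro m
    have h1 := (hb m c hL).trans (ENNReal.ofReal_le_ofReal
      (show (1 + ε / 2) * (L / I) + b m ≤ (1 + ε / 2) * (L / I) + b' by linarith [hbb m]))
    have h2 := errorProb_dgf_le hDgf hDfg hM hKM r m hc0
      (h1.trans_lt ENNReal.ofReal_lt_top).ne
    have h3 := ((dgf hM hKM r c).expectedTime_le f g m).trans h1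
    calc _ ≤ M * ENNReal.ofReal c
          + ENNReal.ofReal c * ENNReal.ofReal ((1 + ε / 2) * (L / I) + b') := by gcongr
      _ = ENNReal.ofReal (M * c + c * ((1 + ε / 2) * (L / I) + b')) := by
          rw [ENNReal.ofReal_add (by positivity) (mul_nonneg hc0.le hpos),
            ENNReal.ofReal_mul (Nat.cast_nonneg _), ENNReal.ofReal_natCast,
            ENNReal.ofReal_mul hc0.le]
      _ ≤ _ := by
          refine ENNReal.ofReal_le_ofReal ?_
          rw [div_le_iff₀ (by positivity)] at hLbig
          have h4 := mul_le_mul_of_nonneg_left hLbig hc0.le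
          have e : -c * Real.log c = c * L := by rw [hLdef]; ring
          have e2 : c * (L * (ε / 2 / I)) = ε / 2 * (c * L / I) := by ring
          have e3 : c * ((1 + ε / 2) * (L / I) + b') = (1 + ε / 2) * (c * L / I) + c * b' := by
            ring
          rw [e, e3]
          rw [e2] at h4
          linarith
  calc _ ≤ ∑ m, ENNReal.ofReal (prior m)
        * ENNReal.ofReal ((1 + ε) * (-c * Real.log c / I)) :=
        Finset.sum_le_sum fun m _ => mul_le_mul_right (hbound m) _
    _ = _ := sum_ofReal_prior_mul hprior hsum _

end Upper

/-! ### The lower bound for all strategies -/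

section Lower

variable {𝓨 : Type*} [MeasurableSpace 𝓨] {f g : Measure 𝓨} {M K : ℕ}

namespace Strategy

lemma mul_measure_lt_stopTime_le (Γ : Strategy 𝓨 M K) (m : Fin M) (n : ℕ) :
    ((n : ℝ≥0∞) + 1) * law f g m {ω | (n : ℕ∞) < Γ.stopTime ω} ≤ Γ.expectedTime f g m := by
  have hmeas : MeasurableSet {ω | (n : ℕ∞) < Γ.stopTime ω} := by
    have : {ω | (n : ℕ∞) < Γ.stopTime ω}
        = ⋂ (t : ℕ) (_ : t ≤ n), {ω | Γ.history ω t ∈ (Γ.stopSet t)ᶜ} := by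
      ext ω; simp [lt_stopTime_iff]
    rw [this]
    exact .iInter fun t => .iInter fun _ =>
      Γ.measurable_history t (Γ.measurableSet_stopSet t).compl
  rw [← lintegral_indicator_const hmeas]
  refine lintegral_mono fun ω => ?_
  by_cases hω : (n : ℕ∞) < Γ.stopTime ω
  · rw [Set.indicator_of_mem (by exact hω)]
    have h1 : ((n + 1 : ℕ) : ℕ∞) ≤ Γ.stopTime ω := by
      push_cast; exact Order.add_one_le_of_lt hω
    simpa using ENat.toENNReal_le.2 h1
  · rw [Set.indicator_of_notMem (by exact hω)]
    exact zero_le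

end Strategy

variable [IsProbabilityMeasure f] [IsProbabilityMeasure g]

/-- A strategy with small error probabilities cannot stop early: its log-likelihood ratios have
to be of the order `-log c` at the time of stopping, and they do not grow faster than
`rate f g M K` allows. -/
lemma eventually_le_expectedTime (hne : f ≠ g) (hDgf : klDiv g f ≠ ∞) (hDfg : klDiv f g ≠ ∞)
    (hM : 2 ≤ M) (hK : 1 ≤ K) (hKM : K ≤ M) (m : Fin M) {D p ε δ : ℝ} (hD : 0 < D) (hp : 0 < p)
    (hp1 : 3 * p < 1) (hε0 : 0 < ε) (hε1 : ε < 1) (hδ : 0 < δ) :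
    ∀ᶠ c in 𝓝[>] (0 : ℝ), ∀ Γ : Strategy 𝓨 M K,
      (∀ k, Γ.errorProb f g k ≤ ENNReal.ofReal (D * (-c * Real.log c))) →
      ENNReal.ofReal ((1 - 3 * p) * ((1 - ε) * -Real.log c / (rate f g M K + 2 * δ)))
        ≤ Γ.expectedTime f g m := by
  have hgf := (klDiv_ne_top_iff.1 hDgf).1
  have hfg := (klDiv_ne_top_iff.1 hDfg).1
  have hI : 0 < rate f g M K := rate_pos hne hDgf hDfg hM hK
  have hMpos : (1 : ℝ) ≤ M := by exact_mod_cast (show 1 ≤ M by omega)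
  obtain ⟨n₀, hn₀⟩ := exists_forall_measure_sumLLR_sub_le (K := K) hDgf hDfg m hδ hp
  have hlog : Filter.Tendsto (fun c : ℝ => -Real.log c) (𝓝[>] 0) Filter.atTop :=
    Filter.tendsto_neg_atBot_atTop.comp Real.tendsto_log_nhdsGT_zero
  have hsmall : Filter.Tendsto (fun c : ℝ =>
      M * (D * (-Real.log c * Real.exp (-ε * -Real.log c)))) (𝓝[>] 0) (𝓝 0) := by
    have h1 : Filter.Tendsto (fun x : ℝ => x * Real.exp (-ε * x)) Filter.atTop (𝓝 0) := by
      simpa using tendsto_rpow_mul_exp_neg_mul_atTop_nhds_zero 1 ε hε0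
    simpa using ((h1.comp hlog).const_mul D).const_mul (M : ℝ)
  set I := rate f g M K with hIdef
  have hIδ : 0 < I + 2 * δ := by positivity
  have hα : 0 < (1 - ε) / (I + 2 * δ) := div_pos (by linarith) hIδ
  filter_upwards [self_mem_nhdsWithin, hlog.eventually_gt_atTop 0,
    hlog.eventually_ge_atTop ((n₀ + 1) / ((1 - ε) / (I + 2 * δ))),
    hsmall.eventually_le_const hp] with c hc0 hL hLbig hcsmall Γ herr
  have hc0 : 0 < c := hc0
  set L := -Real.log c with hLdef
  have hcL : c = Real.exp (-L) := by rw [hLdef, neg_neg, Real.exp_log hc0]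
  set n := ⌊(1 - ε) * L / (I + 2 * δ)⌋₊ with hn
  have hnn₀ : n₀ ≤ n := by
    rw [div_le_iff₀ hα] at hLbig
    refine Nat.le_floor ?_
    have e : L * ((1 - ε) / (I + 2 * δ)) = (1 - ε) * L / (I + 2 * δ) := by ring
    rw [e] at hLbig
    linarith
  have hnle : (I + 2 * δ) * n ≤ (1 - ε) * L := by
    have h1 : (n : ℝ) ≤ (1 - ε) * L / (I + 2 * δ) :=
      Nat.floor_le (div_nonneg (mul_nonneg (by linarith) hL.le) hIδ.le)
    rw [le_div_iff₀ hIδ] at h1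
    linarith
  set Dev : Set (SampleSpace 𝓨 M) := {ω | ∃ t ≤ n, ∃ k, δ * n ≤ |sumLLR f g (Γ.history ω t) k
    - drift f g m k * probes (Γ.history ω t) k|} with hDev
  set E : Fin M → Set (SampleSpace 𝓨 M) := fun k => {ω | ∃ t : ℕ, Γ.stopTime ω = t ∧
    Γ.decide t (Γ.history ω t) = m ∧
    sumLLR f g (Γ.history ω t) m - sumLLR f g (Γ.history ω t) k ≤ (1 - ε) * L} with hE
  have hcover : (Set.univ : Set (SampleSpace 𝓨 M)) ⊆
      (((Γ.declares m)ᶜ ∪ Dev) ∪ ⋃ k ∈ Finset.univ.erase m, E k) ∪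
        {ω | (n : ℕ∞) < Γ.stopTime ω} := by
    intro ω _
    by_contra hcon
    simp only [Set.mem_union, not_or, Set.mem_compl_iff, not_not] at hcon
    obtain ⟨⟨⟨⟨t, ht, hd⟩, hdev⟩, hEk⟩, hlt⟩ := hcon
    have htn : t ≤ n := by
      simp only [Set.mem_ofPred_eq, ht, Nat.cast_lt, not_lt] at hlt
      exact hlt
    have hη : ∀ k, |sumLLR f g (Γ.history ω t) k
        - drift f g m k * probes (Γ.history ω t) k| ≤ δ * n := by
      intro k
      by_contra hk
      exact hdev ⟨t, htn, k, (not_le.1 hk).le⟩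
    obtain ⟨k, hk, hle⟩ := exists_margin_le_rate_mul hM hKM (Γ.history ω t) hη
    refine hEk (Set.mem_biUnion (x := k)
      (by rw [Finset.mem_coe]; exact Finset.mem_erase.2 ⟨hk, Finset.mem_univ k⟩)
      ⟨t, ht, hd, hle.trans ?_⟩)
    have h1 : I * t ≤ I * n := mul_le_mul_of_nonneg_left (by exact_mod_cast htn) hI.le
    linarith
  have hLe : D * (-c * Real.log c) * Real.exp ((1 - ε) * L)
      = D * (L * Real.exp (-ε * L)) := by
    have e : -c * Real.log c = c * L := by rw [hLdef]; ring
    have e2 : Real.exp (-ε * L) = c * Real.exp ((1 - ε) * L) := by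
      conv_rhs => rw [hcL]
      rw [← Real.exp_add]
      congr 1; ring
    rw [e, e2]; ring
  have hcLog : 0 ≤ -c * Real.log c := by
    have e : -c * Real.log c = c * L := by rw [hLdef]; ring
    rw [e]; positivity
  have hEle : ∀ k ∈ Finset.univ.erase m, law f g m (E k)
      ≤ ENNReal.ofReal (D * (L * Real.exp (-ε * L))) := by
    intro k hk
    have hkm := Finset.ne_of_mem_erase hk
    calc law f g m (E k) ≤ ENNReal.ofReal (Real.exp ((1 - ε) * L)) * law f g k (Γ.declares m) :=
          Γ.measure_declares_sumLLR_le f g hfg hgf hkm.symm m _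
      _ ≤ ENNReal.ofReal (Real.exp ((1 - ε) * L)) * Γ.errorProb f g k := by
          gcongr
          refine measure_mono ?_
          rintro ω ⟨t, ht, hd⟩ ⟨t', ht', hd'⟩
          have : t = t' := by exact_mod_cast ht.symm.trans ht'
          subst this
          exact hkm (hd'.symm.trans hd)
      _ ≤ ENNReal.ofReal (Real.exp ((1 - ε) * L))
            * ENNReal.ofReal (D * (-c * Real.log c)) := by gcongr; exact herr k
      _ = _ := by
          rw [← ENNReal.ofReal_mul (Real.exp_pos _).le, mul_comm, hLe]
  have hdecl : law f g m (Γ.declares m)ᶜ ≤ ENNReal.ofReal p := by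
    refine (herr m).trans (ENNReal.ofReal_le_ofReal ?_)
    have h1 : D * (-c * Real.log c) * 1 ≤ D * (-c * Real.log c) * Real.exp ((1 - ε) * L) :=
      mul_le_mul_of_nonneg_left (Real.one_le_exp (mul_nonneg (by linarith) hL.le))
        (mul_nonneg hD.le hcLog)
    have h2 : D * (L * Real.exp (-ε * L)) ≤ M * (D * (L * Real.exp (-ε * L))) :=
      le_mul_of_one_le_left (by positivity) hMpos
    linarith
  have hEsum : law f g m (⋃ k ∈ Finset.univ.erase m, E k) ≤ ENNReal.ofReal p := by
    refine (measure_biUnion_finset_le _ _).trans ((Finset.sum_le_sum hEle).trans ?_)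
    refine (Finset.sum_le_sum_of_subset (Finset.erase_subset m Finset.univ)).trans ?_
    rw [Finset.sum_const, Finset.card_univ, Fintype.card_fin, nsmul_eq_mul,
      ← ENNReal.ofReal_natCast, ← ENNReal.ofReal_mul (Nat.cast_nonneg _)]
    exact ENNReal.ofReal_le_ofReal hcsmall
  have hlate : ENNReal.ofReal (1 - 3 * p) ≤ law f g m {ω | (n : ℕ∞) < Γ.stopTime ω} := by
    have h1 : (1 : ℝ≥0∞) ≤ ENNReal.ofReal (3 * p)
        + law f g m {ω | (n : ℕ∞) < Γ.stopTime ω} := by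
      calc (1 : ℝ≥0∞) = law f g m Set.univ := measure_univ.symm
        _ ≤ _ := measure_mono hcover
        _ ≤ ((law f g m (Γ.declares m)ᶜ + law f g m Dev)
              + law f g m (⋃ k ∈ Finset.univ.erase m, E k))
              + law f g m {ω | (n : ℕ∞) < Γ.stopTime ω} :=
            (measure_union_le _ _).trans (add_le_add_left ((measure_union_le _ _).trans
              (add_le_add_left (measure_union_le _ _) _)) _)
        _ ≤ ((ENNReal.ofReal p + ENNReal.ofReal p) + ENNReal.ofReal p)
              + law f g m {ω | (n : ℕ∞) < Γ.stopTime ω} := by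
            gcongr
            exact hn₀ n hnn₀ Γ
        _ = _ := by
            rw [← ENNReal.ofReal_add hp.le hp.le, ← ENNReal.ofReal_add (by positivity) hp.le]
            congr 2; ring
    have h2 : (1 : ℝ≥0∞) = ENNReal.ofReal (3 * p) + ENNReal.ofReal (1 - 3 * p) := by
      rw [← ENNReal.ofReal_add (by positivity) (by linarith)]; simp
    rw [h2] at h1
    exact (ENNReal.add_le_add_iff_left ENNReal.ofReal_ne_top).1 h1
  calc ENNReal.ofReal ((1 - 3 * p) * ((1 - ε) * L / (I + 2 * δ)))
      ≤ ENNReal.ofReal ((n + 1) * (1 - 3 * p)) := by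
        refine ENNReal.ofReal_le_ofReal ?_
        rw [mul_comm]
        exact mul_le_mul_of_nonneg_right (Nat.lt_floor_add_one _).le (by linarith)
    _ = ((n : ℝ≥0∞) + 1) * ENNReal.ofReal (1 - 3 * p) := by
        rw [ENNReal.ofReal_mul (by positivity), ENNReal.ofReal_add (Nat.cast_nonneg _) zero_le_one]
        simp
    _ ≤ ((n : ℝ≥0∞) + 1) * law f g m {ω | (n : ℕ∞) < Γ.stopTime ω} := by gcongr
    _ ≤ _ := Γ.mul_measure_lt_stopTime_le m n

/-- No strategy has a risk below `-(1 - ε) c log c / I*(M, K)` when `c` is small. -/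
lemma eventually_le_bayesRisk (hne : f ≠ g) (hDgf : klDiv g f ≠ ∞)
    (hDfg : klDiv f g ≠ ∞) (hM : 2 ≤ M) (hK : 1 ≤ K) (hKM : K ≤ M)
    {prior : Fin M → ℝ} (hprior : ∀ m, 0 < prior m) (hsum : ∑ m, prior m = 1) {ε : ℝ}
    (hε0 : 0 < ε) (hε1 : ε < 1) :
    ∀ᶠ c in 𝓝[>] (0 : ℝ), ∀ Γ : Strategy 𝓨 M K,
      ENNReal.ofReal ((1 - ε) * (-c * Real.log c / rate f g M K))
        ≤ Γ.bayesRisk f g prior c := by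
  have hI : 0 < rate f g M K := rate_pos hne hDgf hDfg hM hK
  set I := rate f g M K with hIdef
  set D := ∑ k, 1 / (I * prior k) with hDdef
  have hDk : ∀ k, 1 / (I * prior k) ≤ D := fun k =>
    Finset.single_le_sum (f := fun k => 1 / (I * prior k))
      (fun k _ => (one_div_pos.2 (mul_pos hI (hprior k))).le) (Finset.mem_univ k)
  have hD : 0 < D := (one_div_pos.2 (mul_pos hI (hprior ⟨0, by omega⟩))).trans_le (hDk _)
  -- three losses by a factor of at least `1 - ε / 4`
  have hδ : 0 < I * ε / 8 := by positivity
  have hlower := Filter.eventually_all.2 fun m : Fin M =>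
    eventually_le_expectedTime (K := K) hne hDgf hDfg hM hK hKM m hD
      (show 0 < ε / 12 by positivity) (by linarith) (show 0 < ε / 4 by positivity) (by linarith) hδ
  have hlog : Filter.Tendsto (fun c : ℝ => -Real.log c) (𝓝[>] 0) Filter.atTop :=
    Filter.tendsto_neg_atBot_atTop.comp Real.tendsto_log_nhdsGT_zero
  filter_upwards [self_mem_nhdsWithin, hlog.eventually_gt_atTop 0, hlower] with c hc0 hL hc Γ
  have hc0 : 0 < c := hc0
  have hcL : 0 ≤ -c * Real.log c := by
    have := mul_pos hc0 hL
    linarith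
  -- only strategies that beat the claimed rate have to be considered
  by_cases hR : ENNReal.ofReal (-c * Real.log c / I) ≤ Γ.bayesRisk f g prior c
  · refine le_trans (ENNReal.ofReal_le_ofReal ?_) hR
    have : 0 ≤ -c * Real.log c / I := by positivity
    nlinarith
  · rw [not_le] at hR
    have herr : ∀ k, Γ.errorProb f g k ≤ ENNReal.ofReal (D * (-c * Real.log c)) := by
      intro k
      have h1 : ENNReal.ofReal (prior k) * Γ.errorProb f g k
          ≤ ENNReal.ofReal (-c * Real.log c / I) := by
        refine le_trans ?_ hR.le
        refine le_trans ?_ (Finset.single_le_sum (f := fun m => ENNReal.ofReal (prior m) *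
          (Γ.errorProb f g m + ENNReal.ofReal c * Γ.expectedTime f g m))
          (fun _ _ => zero_le) (Finset.mem_univ k))
        gcongr
        exact le_self_add
      have h2 : Γ.errorProb f g k
          ≤ ENNReal.ofReal (-c * Real.log c / I) / ENNReal.ofReal (prior k) := by
        rw [ENNReal.le_div_iff_mul_le (Or.inl (by simpa using hprior k))
          (Or.inl ENNReal.ofReal_ne_top), mul_comm]
        exact h1
      refine h2.trans ?_
      rw [← ENNReal.ofReal_div_of_pos (hprior k)]
      refine ENNReal.ofReal_le_ofReal ?_
      have h3 := mul_le_mul_of_nonneg_right (hDk k) hcL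
      have e : -c * Real.log c / I / prior k = 1 / (I * prior k) * (-c * Real.log c) := by
        field_simp
      rw [e]; exact h3
    have hE := fun m => hc m Γ herr
    calc ENNReal.ofReal ((1 - ε) * (-c * Real.log c / I))
        ≤ ENNReal.ofReal (c * ((1 - 3 * (ε / 12))
            * ((1 - ε / 4) * -Real.log c / (I + 2 * (I * ε / 8))))) := by
          refine ENNReal.ofReal_le_ofReal ?_
          set x := -c * Real.log c / I with hx
          have hx0 : 0 ≤ x := by positivity
          have e : c * ((1 - 3 * (ε / 12)) * ((1 - ε / 4) * -Real.log c / (I + 2 * (I * ε / 8))))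
              = (1 - ε / 4) * (1 - ε / 4) / (1 + ε / 4) * x := by
            rw [hx]; field_simp; ring
          rw [e]
          refine mul_le_mul_of_nonneg_right ?_ hx0
          rw [le_div_iff₀ (by positivity)]
          nlinarith
      _ = ∑ m, ENNReal.ofReal (prior m) * ENNReal.ofReal (c * ((1 - 3 * (ε / 12))
            * ((1 - ε / 4) * -Real.log c / (I + 2 * (I * ε / 8))))) :=
          (sum_ofReal_prior_mul hprior hsum _).symm
      _ ≤ _ := by
          refine Finset.sum_le_sum fun m _ => mul_le_mul_right ?_ _
          rw [ENNReal.ofReal_mul hc0.le]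
          exact (mul_le_mul_right (hE m) _).trans le_add_self

end Lower

/-! ### Asymptotic optimality -/

lemma asympEq_of_eventually {u : ℝ → ℝ≥0∞} {v : ℝ → ℝ} (hv : ∀ᶠ c in 𝓝[>] (0 : ℝ), 0 < v c)
    (hlow : ∀ ε : ℝ, 0 < ε → ε < 1 →
      ∀ᶠ c in 𝓝[>] (0 : ℝ), ENNReal.ofReal ((1 - ε) * v c) ≤ u c)
    (hup : ∀ ε : ℝ, 0 < ε → ∀ᶠ c in 𝓝[>] (0 : ℝ), u c ≤ ENNReal.ofReal ((1 + ε) * v c)) :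
    AsympEq u fun c => ENNReal.ofReal (v c) := by
  unfold AsympEq
  refine tendsto_order.2 ⟨fun a ha => ?_, fun a ha => ?_⟩
  · have ha' : a.toReal < 1 := by
      simpa using (ENNReal.toReal_lt_toReal ha.ne_top ENNReal.one_ne_top).2 ha
    have ha0 : 0 ≤ a.toReal := ENNReal.toReal_nonneg
    set ε := (1 - a.toReal) / 2 with hε
    filter_upwards [hv, hlow ε (by linarith) (by linarith)] with c hc h
    have h1 : ENNReal.ofReal (1 - ε) ≤ u c / ENNReal.ofReal (v c) := by
      rw [ENNReal.le_div_iff_mul_le (Or.inl (by simpa using hc)) (Or.inl ENNReal.ofReal_ne_top),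
        ← ENNReal.ofReal_mul (by linarith)]
      exact h
    refine lt_of_lt_of_le ?_ h1
    rw [← ENNReal.ofReal_toReal ha.ne_top]
    exact (ENNReal.ofReal_lt_ofReal_iff (by linarith)).2 (by linarith)
  · obtain ⟨b, hb1, hba⟩ := exists_between ha
    have hb : b ≠ ⊤ := hba.ne_top
    have hb' : 1 < b.toReal := by
      simpa using (ENNReal.toReal_lt_toReal ENNReal.one_ne_top hb).2 hb1
    filter_upwards [hv, hup (b.toReal - 1) (by linarith)] with c hc h
    refine lt_of_le_of_lt ?_ hba
    refine ENNReal.div_le_of_le_mul (h.trans (le_of_eq ?_))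
    rw [add_sub_cancel, ENNReal.ofReal_mul (by linarith), ENNReal.ofReal_toReal hb]

lemma AsympEq.symm {u v : ℝ → ℝ≥0∞} (h : AsympEq u v)
    (hv : ∀ᶠ c in 𝓝[>] (0 : ℝ), v c ≠ 0 ∧ v c ≠ ∞) : AsympEq v u := by
  have h1 := h.inv
  rw [inv_one] at h1
  refine h1.congr' ?_
  filter_upwards [hv] with c hc
  exact ENNReal.inv_div (Or.inl hc.2) (Or.inl hc.1)

end AnomalyDetection

end

theorem theorem1 {𝓨 : Type*} [MeasurableSpace 𝓨]
    (f g : Measure 𝓨) [IsProbabilityMeasure f] [IsProbabilityMeasure g] (hfg : f ≠ g)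
    (hDgf : klDiv g f ≠ ∞) (hDfg : klDiv f g ≠ ∞)
    (M K : ℕ) (hM : 2 ≤ M) (hK : 1 ≤ K) (hKM : K ≤ M)
    (prior : Fin M → ℝ) (hprior : ∀ m, 0 < prior m ∧ prior m < 1) (hsum : ∑ m, prior m = 1)
    (r : AnomalyDetection.Ranking f g M K) :
    AnomalyDetection.AsympEq
      (fun c => (AnomalyDetection.dgf hM hKM r c).bayesRisk f g prior c)
      (fun c => ENNReal.ofReal (-c * Real.log c / AnomalyDetection.rate f g M K)) ∧
    AnomalyDetection.AsympEq
      (fun c => ENNReal.ofReal (-c * Real.log c / AnomalyDetection.rate f g M K))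
      (fun c => ⨅ Γ : AnomalyDetection.Strategy 𝓨 M K, Γ.bayesRisk f g prior c) := by
  open AnomalyDetection in
  have hprior0 : ∀ m, 0 < prior m := fun m => (hprior m).1
  have hI : 0 < rate f g M K := rate_pos hfg hDgf hDfg hM hK
  have hv : ∀ᶠ c in 𝓝[>] (0 : ℝ), 0 < -c * Real.log c / rate f g M K := by
    have h1 : ∀ᶠ c in 𝓝[>] (0 : ℝ), c < 1 :=
      Filter.Tendsto.eventually_lt_const one_pos (nhdsWithin_le_nhds : 𝓝[>] (0 : ℝ) ≤ 𝓝 0)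
    filter_upwards [self_mem_nhdsWithin, h1] with c hc0 hc1
    have hc0 : 0 < c := hc0
    have := mul_pos hc0 (neg_pos.2 (Real.log_neg hc0 hc1))
    exact div_pos (by linarith) hI
  have hup := fun (ε : ℝ) (hε : 0 < ε) =>
    eventually_bayesRisk_dgf_le hfg hDgf hDfg hM hK hKM r hprior0 hsum hε
  have hlow := fun (ε : ℝ) (hε0 : 0 < ε) (hε1 : ε < 1) =>
    eventually_le_bayesRisk (K := K) hfg hDgf hDfg hM hK hKM hprior0 hsum hε0 hε1
  refine ⟨asympEq_of_eventually hv (fun ε hε0 hε1 => ?_) hup, AsympEq.symm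
    (asympEq_of_eventually hv (fun ε hε0 hε1 => ?_) fun ε hε => ?_) ?_⟩
  · filter_upwards [hlow ε hε0 hε1] with c hc using hc _
  · filter_upwards [hlow ε hε0 hε1] with c hc using le_iInf hc
  · filter_upwards [hup ε hε] with c hc using (iInf_le _ _).trans hc
  · filter_upwards [hv] with c hc
    exact ⟨by simpa using hc, ENNReal.ofReal_ne_top⟩
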